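/- Let $n\ge 1$ be an integer, $p>-n$ real and $\hbar>0$. For $\mathbf z,\mathbf w\in\mathbb C^n$ write $\mathbf z\cdot\mathbf w=\sum_{l=1}^n z_l\overline{w_l}$ and $|\mathbf z|=\sqrt{\mathbf z\cdot\mathbf z}$; for $\mathbf k\in\mathbb Z_{\ge0}^n$ write $|\mathbf k|=\sum_l k_l$, $\mathbf k!=\prod_l k_l!$, $\mathbf z^{\mathbf k}=\prod_l z_l^{k_l}$; and for $b>0$ let $(b)_\ell=\Gamma(b+\ell)/\Gamma(b)$. Let $\mathrm I_\nu$ and $\mathrm K_\nu$ be the modified Bessel functions of the first and second kind of order $\nu$, and let $$\mathrm dm_{n,p}^\hbar(\mathbf z)=\frac{1}{\Gamma(n+p)}\,\frac{2}{(\pi\hbar^2)^n}\Big(\frac{|\mathbf z|}{\hbar}\Big)^{p}\,\mathrm K_p\Big(\frac{2|\mathbf z|}{\hbar}\Big)\,\mathrm d\mathbf z,$$ where $\mathrm d\mathbf z$ is Lebesgue measure on $\mathbb C^n\cong\mathbb R^{2n}$. Let $\mathcal E_{n,p}$ be the space of entire functions $f$ on $\mathbb C^n$ with $\int|f|^2\,\mathrm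 dm_{n,p}^\hbar<\infty$, with the inner product $(f,g)_p=\int_{\mathbb C^n} f\,\overline g\,\mathrm dm_{n,p}^\hbar$. Then $\mathcal E_{n,p}$ is a Hilbert space (in particular, two of its elements that agree almost everywhere are equal), and the following hold. a) The analytic polynomials on $\mathbb C^n$ belong to $\mathcal E_{n,p}$ and are dense in it. b) Let $W_\ell$ be the space of homogeneous polynomials of degree $\ell$ on $\mathbb C^n$, $\ell\ge 0$. Then $\mathcal E_{n,p}=\bigoplus_{\ell=0}^\infty W_\ell$ as an orthogonal Hilbert direct sum, and the functions $$\Phi_{\mathbf k,p}^\hbar(\mathbf z)=\frac{1}{\hbar^{|\mathbf k|}}\sqrt{\frac{1}{(n+p)_{|\mathbf k|}\,\mathbf k!}}\;\mathbf z^{\mathbf k},\qquad \mathbf k\in\mathbb Z_{\ge0}^n,$$ form an orthonormal (Hilbert) basis of $\mathcal E_{n,p}$. c) $\mathcal E_{n,p}$ has the reproducing kernel $$\mathbf T_{n,p}(\mathbf z,\mathbf w)=\Gamma(n+p)\Big(\frac{\mathbf z\cdot\mathbf w}{\hbar^2}\Big)^{\frac12(1-p-n)}\mathrm I_{n+p-1}\Big(\frac{2\sqrt{\mathbf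 z\cdot\mathbf w}}{\hbar}\Big)$$ (principal branches; where $\mathbf z\cdot\mathbf w=0$ the right-hand side is understood as its limit, which is $1$). That is, $\mathbf T_{n,p}(\cdot,\mathbf z)\in\mathcal E_{n,p}$ for all $\mathbf z\in\mathbb C^n$, and for all $f\in\mathcal E_{n,p}$ and $\mathbf z\in\mathbb C^n$ $$f(\mathbf z)=(f,\mathbf T_{n,p}(\cdot,\mathbf z))_p=\int_{\mathbb C^n} f(\mathbf w)\,\mathbf T_{n,p}(\mathbf z,\mathbf w)\,\mathrm dm_{n,p}^\hbar(\mathbf w).$$ The kernel $\mathbf T_{n,p}$ is continuous on $\mathbb C^n\times\mathbb C^n$, and for all $\mathbf z,\mathbf w\in\mathbb C^n$ $$\mathbf T_{n,p}(\mathbf z,\mathbf w)=\sum_{\ell=0}^\infty\mathbf T_{n,p}^\ell(\mathbf z,\mathbf w),\qquad \mathbf T_{n,p}^\ell(\mathbf z,\mathbf w)=\frac{1}{\ell!\,(n+p)_\ell}\Big(\frac{\mathbf z\cdot\mathbf w}{\hbar^2}\Big)^\ell,$$ where $\mathbf T_{n,p}^\ell$ is the reproducing kernel of the subspace $W_\ell$.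 -/

import Mathlib

open MeasureTheory ComplexConjugate

noncomputable section

namespace BesselFock

/-- The space `ℂⁿ`; its `volume` is Lebesgue measure on `ℂⁿ ≃ ℝ²ⁿ` (a product of area measures). -/
abbrev Cn (n : ℕ) : Type := Fin n → ℂ

/-- The Hermitian product `z · w = ∑ z_l * conj (w_l)`, linear in the first variable. -/
def dot {n : ℕ} (z w : Cn n) : ℂ := ∑ l, z l * conj (w l)

/-- The Euclidean length `|z| = √(z · z)` (the built-in norm of `Fin n → ℂ` is the sup norm). -/
def len {n : ℕ} (z : Cn n) : ℝ := Real.sqrt (∑ l, ‖z l‖ ^ 2)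

/-- `|z|` is indeed the length attached to the Hermitian product. -/
theorem dot_self {n : ℕ} (z : Cn n) : dot z z = ((len z ^ 2 : ℝ) : ℂ) := by
  have h : (0 : ℝ) ≤ ∑ l, ‖z l‖ ^ 2 := Finset.sum_nonneg fun l _ => by positivity
  simp only [dot, len, Real.sq_sqrt h, Complex.mul_conj, Complex.normSq_eq_norm_sq,
    Complex.ofReal_sum]

/-- The Macdonald function (modified Bessel function of the second kind) of real order `ν`,
`K_ν(x) = ∫_0^∞ exp(-x cosh t) cosh(ν t) dt` for `x > 0`. -/
def macdonaldK (ν x : ℝ) : ℝ :=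
  ∫ t in Set.Ioi (0 : ℝ), Real.exp (-(x * Real.cosh t)) * Real.cosh (ν * t)

/-- The modified Bessel function of the first kind of real order `ν`,
`I_ν(x) = (x/2)^ν ∑ (x/2)^(2j) / (j! Γ(ν+j+1))`, with the principal branch of the power. -/
def besselI (ν : ℝ) (x : ℂ) : ℂ :=
  (x / 2) ^ (ν : ℂ) *
    ∑' j : ℕ, (x / 2) ^ (2 * j) / ((j.factorial : ℂ) * (Real.Gamma (ν + j + 1) : ℂ))

/-- The Pochhammer symbol `(b)_l = Γ(b + l) / Γ(b)`. -/
def poch (b : ℝ) (l : ℕ) : ℝ := Real.Gamma (b + l) / Real.Gamma b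

/-- The measure `Γ(n+p)⁻¹ · 2 (π ħ²)⁻ⁿ · (|z|/ħ)^p · K_p(2|z|/ħ) dz` on `ℂⁿ`. -/
def fockMeasure (n : ℕ) (p ħ : ℝ) : Measure (Cn n) :=
  volume.withDensity fun z => ENNReal.ofReal
    (1 / Real.Gamma (n + p) * (2 / (Real.pi * ħ ^ 2) ^ n) * (len z / ħ) ^ p *
      macdonaldK p (2 * (len z / ħ)))

/-- The space of entire functions on `ℂⁿ` that are square integrable for `fockMeasure`. -/
def entireSpace (n : ℕ) (p ħ : ℝ) : Submodule ℂ (Cn n → ℂ) where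
  carrier := {f | Differentiable ℂ f ∧ MemLp f 2 (fockMeasure n p ħ)}
  add_mem' hf hg := ⟨hf.1.add hg.1, hf.2.add hg.2⟩
  zero_mem' := ⟨differentiable_const 0, MemLp.zero⟩
  smul_mem' c _ hf := ⟨hf.1.const_smul c, hf.2.const_smul c⟩

/-- Evaluation of polynomials, as a linear map to functions on `ℂⁿ`. -/
def polyEval (n : ℕ) : MvPolynomial (Fin n) ℂ →ₗ[ℂ] (Cn n → ℂ) where
  toFun q z := MvPolynomial.eval z q
  map_add' q r := by ext z; simp
  map_smul' c q := by ext z; simp [MvPolynomial.smul_eval]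

/-- The analytic polynomial functions on `ℂⁿ`. -/
def polySpace (n : ℕ) : Submodule ℂ (Cn n → ℂ) := LinearMap.range (polyEval n)

/-- The homogeneous polynomial functions of degree `l` on `ℂⁿ` (including `0`). -/
def homogSpace (n l : ℕ) : Submodule ℂ (Cn n → ℂ) :=
  (MvPolynomial.homogeneousSubmodule (Fin n) ℂ l).map (polyEval n)

/-- The classes in `L²(μ)` that have a representative in a given space `H` of functions. -/
def l2Classes {α : Type*} [MeasurableSpace α] (μ : Measure α) (H : Submodule ℂ (α → ℂ)) :
    Submodule ℂ (Lp ℂ 2 μ) where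
  carrier := {F | ∃ f ∈ H, (F : α → ℂ) =ᵐ[μ] f}
  add_mem' := by
    rintro F G ⟨f, hf, hFf⟩ ⟨g, hg, hGg⟩
    exact ⟨f + g, H.add_mem hf hg, (Lp.coeFn_add F G).trans (hFf.add hGg)⟩
  zero_mem' := ⟨0, H.zero_mem, Lp.coeFn_zero ℂ 2 μ⟩
  smul_mem' := by
    rintro c F ⟨f, hf, hFf⟩
    exact ⟨c • f, H.smul_mem c hf, (Lp.coeFn_smul c F).trans (hFf.const_smul c)⟩

/-- The space `𝓔_{n,p}` with the inner product inherited from `L²(ℂⁿ, fockMeasure)`. -/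
abbrev fockSpace (n : ℕ) (p ħ : ℝ) : Submodule ℂ (Lp ℂ 2 (fockMeasure n p ħ)) :=
  l2Classes (fockMeasure n p ħ) (entireSpace n p ħ)

/-- A space `H` of functions, seen as a subspace of `𝓔_{n,p}`. -/
def inFock {n : ℕ} (p ħ : ℝ) (H : Submodule ℂ (Cn n → ℂ)) : Submodule ℂ (fockSpace n p ħ) :=
  (l2Classes (fockMeasure n p ħ) H).comap (fockSpace n p ħ).subtype

/-- The normalized monomial `Φ_k(z) = ħ^(-|k|) ((n+p)_{|k|} k!)^(-1/2) z^k`. -/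
def normMonomial {n : ℕ} (p ħ : ℝ) (k : Fin n → ℕ) (z : Cn n) : ℂ :=
  ((1 / ħ ^ (∑ i, k i) *
      Real.sqrt (1 / (poch (n + p) (∑ i, k i) * ∏ i, ((k i).factorial : ℝ))) : ℝ) : ℂ) *
    ∏ i, z i ^ k i

/-- `T` is the reproducing kernel of the space `H` of functions for the pairing
`(f, g) = ∫ f * conj g ∂μ`. -/
def IsReproducingKernel {α : Type*} [MeasurableSpace α] (μ : Measure α)
    (H : Submodule ℂ (α → ℂ)) (T : α → α → ℂ) : Prop :=
  (∀ z, (fun w => T w z) ∈ H) ∧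
    ∀ f ∈ H, ∀ z, Integrable (fun w => f w * conj (T w z)) μ ∧
      f z = ∫ w, f w * conj (T w z) ∂μ

/-- The kernel `Γ(n+p) (z·w/ħ²)^((1-p-n)/2) I_{n+p-1}(2 √(z·w) / ħ)`, principal branches.
Where `z · w = 0` the formula has a removable singularity and the kernel takes the limit `1`. -/
def kernel (n : ℕ) (p ħ : ℝ) (z w : Cn n) : ℂ :=
  if dot z w = 0 then 1
  else (Real.Gamma (n + p) : ℂ) *
    (dot z w / (ħ : ℂ) ^ 2) ^ (((1 - p - n) / 2 : ℝ) : ℂ) *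
    besselI (n + p - 1) (2 * (dot z w) ^ (1 / 2 : ℂ) / (ħ : ℂ))

/-- The kernel `(z·w/ħ²)^l / (l! (n+p)_l)`. -/
def kernelPart (n : ℕ) (p ħ : ℝ) (l : ℕ) (z w : Cn n) : ℂ :=
  1 / ((l.factorial : ℂ) * (poch (n + p) l : ℂ)) * (dot z w / (ħ : ℂ) ^ 2) ^ l

end BesselFock

end

/-!
The density of `fockMeasure` is a mixture of Gaussians. Substituting `t = r exp u` in the integral
that defines `K_p` gives `2 r^p K_p(2r) = ∫ t^(p-1) exp(-t - r²/t) dt` (`ofReal_macdonaldK`), so a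
point distributed according to `fockMeasure` is `ħ √t` times a standard complex Gaussian vector,
with `t` following the Gamma law of parameter `n + p`. The moments of the coordinates are therefore
products of Gaussian and Gamma moments (`lintegral_monomial`). As the density depends only on `|z|`,
the torus acts by measure preserving maps, so distinct monomials are orthogonal, and the functions
`normMonomial` are orthonormal (`integral_normMonomial_mul_conj`). By the multinomial theorem
`kernelPart` is the sum of `Φ_k(z) conj Φ_k(w)` over `|k| = l`, which makes it the reproducing
kernel of the homogeneous polynomials of degree `l`.

Let `f` be entire and square integrable. Its Taylor component of degree `l` at the origin is the
average of `u^(-l) f(u z)` over the unit circle, and it is a homogeneous polynomial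
(`taylorTerm_mem_homogSpace`). Averaging the pairing of `f` with a homogeneous polynomial of degree
`l` over the circle action shows that only this component contributes
(`integral_mul_conj_eq_integral_taylorTerm`). Hence the component at `z` is the pairing of `f` with
`kernelPart l · z`. The `L²` norms of these kernels are summable over `l`, so their sum in `L²` is
`kernel · z`, and summing the Taylor series gives the reproducing property (`inner_kernelVec`).

Two consequences complete the proof. An `L²` limit `F` of functions in the space coincides almost
everywhere with `z ↦ ⟨kernel · z, F⟩`, a locally uniformly convergent series of polynomials; so the
space is closed in `L²` (`isClosed_fockSpace`). A function in the space that is orthogonal to all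
monomials has vanishing Taylor components, so it is zero (`orthogonal_span_monomialVec`).
-/

noncomputable section

namespace BesselFock

/-! ### Entire functions of several variables -/

section Entire

open Metric Topology Complex

variable {E : Type*} [NormedAddCommGroup E] [NormedSpace ℂ E]

/-- Cauchy's estimate in several variables; the Schwarz lemma, applied to `f - f x`, costs the
factor `2`. -/
theorem norm_fderiv_le_of_norm_le_on_ball {f : E → ℂ} (hf : Differentiable ℂ f) {x : E} {r C : ℝ}
    (hr : 0 < r) (hC : ∀ y ∈ ball x r, ‖f y‖ ≤ C) : ‖fderiv ℂ f x‖ ≤ 2 * C / r := by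
  refine norm_fderiv_le_div_of_mapsTo_ball hf.differentiableOn (fun y hy => ?_) hr
  rw [mem_closedBall, dist_eq_norm]
  calc ‖f y - f x‖ ≤ ‖f y‖ + ‖f x‖ := norm_sub_le _ _
    _ ≤ 2 * C := by linarith [hC y hy, hC x (mem_ball_self hr)]

/-- A series of entire functions that is dominated by a convergent numerical series on every ball
of radius `2` is entire. -/
theorem differentiable_tsum_of_norm_le_on_ball {f : ℕ → E → ℂ} (hf : ∀ l, Differentiable ℂ (f l))
    (h : ∀ x, ∃ u : ℕ → ℝ, Summable u ∧ ∀ l, ∀ y ∈ ball x 2, ‖f l y‖ ≤ u l) :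
    Differentiable ℂ fun x => ∑' l, f l x := by
  intro x
  obtain ⟨u, hu, hb⟩ := h x
  let : NormedSpace ℝ E := NormedSpace.restrictScalars ℝ ℂ E
  refine (hasFDerivAt_tsum_of_isPreconnected (u := fun l => 2 * u l / 1) (s := ball x 1)
    (f' := fun l => fderiv ℂ (f l)) (x₀ := x)
    ((hu.mul_left 2).div_const 1) isOpen_ball (convex_ball x 1).isPreconnected
    (fun l y _ => (hf l y).hasFDerivAt) (fun l y hy => ?_) (mem_ball_self one_pos) ?_
    (mem_ball_self one_pos)).differentiableAt
  · refine norm_fderiv_le_of_norm_le_on_ball (hf l) one_pos fun z hz => hb l z ?_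
    rw [mem_ball] at hy hz ⊢
    linarith [dist_triangle z y x]
  · exact Summable.of_norm_bounded hu fun l => hb l x (mem_ball_self two_pos)

theorem iteratedDeriv_zero_eq_circle_average {g : ℂ → ℂ} (hg : Differentiable ℂ g) (l : ℕ) :
    (l.factorial : ℂ)⁻¹ * iteratedDeriv l g 0 =
      (2 * Real.pi : ℂ)⁻¹ * ∫ θ in (0 : ℝ)..2 * Real.pi,
        ((circleMap 0 1 θ)⁻¹) ^ l * g (circleMap 0 1 θ) := by
  have h := DiffContOnCl.circleIntegral_one_div_sub_center_pow_smul (c := 0) one_pos l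
    (hg.diffContOnCl (s := ball 0 1))
  rw [circleIntegral] at h
  have h2 : ∀ θ : ℝ, deriv (circleMap 0 1) θ • (1 / (circleMap 0 1 θ - 0) ^ (l + 1)) •
      g (circleMap 0 1 θ) = I * (((circleMap 0 1 θ)⁻¹) ^ l * g (circleMap 0 1 θ)) := by
    intro θ
    have hne : circleMap 0 1 θ ≠ 0 := circleMap_ne_center one_ne_zero
    simp only [deriv_circleMap, smul_eq_mul, sub_zero, inv_pow]
    field_simp
    ring
  simp only [h2, intervalIntegral.integral_const_mul] at h
  rw [smul_eq_mul] at h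
  have hI := I_ne_zero
  have hpi : (Real.pi : ℂ) ≠ 0 := by exact_mod_cast Real.pi_ne_zero
  have hl : (l.factorial : ℂ) ≠ 0 := by exact_mod_cast l.factorial_ne_zero
  have h3 : (∫ θ in (0 : ℝ)..2 * Real.pi, ((circleMap 0 1 θ)⁻¹) ^ l * g (circleMap 0 1 θ)) =
      2 * Real.pi / l.factorial * iteratedDeriv l g 0 := by
    apply mul_left_cancel₀ hI
    rw [h]; ring
  rw [h3]; field_simp

/-- Directional derivatives of entire functions of several variables are entire: by Cauchy's
formula they are circle averages of translates of the function. -/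
theorem differentiable_fderiv_apply [FiniteDimensional ℂ E] {f : E → ℂ}
    (hf : Differentiable ℂ f) (v : E) : Differentiable ℂ fun z => fderiv ℂ f z v := by
  have hform : ∀ z, fderiv ℂ f z v = (2 * Real.pi : ℂ)⁻¹ * ∫ θ in (0 : ℝ)..2 * Real.pi,
      (circleMap 0 1 θ)⁻¹ * f (z + circleMap 0 1 θ • v) := by
    intro z
    have hg : Differentiable ℂ fun s : ℂ => f (z + s • v) :=
      hf.comp ((differentiable_const z).add (differentiable_id.smul_const v))
    have hd : deriv (fun s : ℂ => f (z + s • v)) 0 = fderiv ℂ f z v := by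
      have h1 : HasFDerivAt f (fderiv ℂ f z) (z + (0 : ℂ) • v) := by
        simpa using (hf z).hasFDerivAt
      have h2 : HasDerivAt (fun s : ℂ => z + s • v) v 0 := by
        simpa using ((hasDerivAt_id (0 : ℂ)).smul_const v).const_add z
      exact (h1.comp_hasDerivAt (0 : ℂ) h2).deriv
    have := iteratedDeriv_zero_eq_circle_average hg 1
    simpa [iteratedDeriv_one, hd] using this
  simp only [hform]
  refine Differentiable.const_mul (fun z₀ => ?_) _
  have : ProperSpace E := FiniteDimensional.proper ℂ E
  obtain ⟨C, hC⟩ := (isCompact_closedBall z₀ (2 + ‖v‖)).exists_bound_of_continuousOn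
    hf.continuous.continuousOn
  have hcont : Continuous fun θ : ℝ => (circleMap 0 1 θ)⁻¹ :=
    (continuous_circleMap 0 1).inv₀ fun θ => circleMap_ne_center one_ne_zero
  have hn : ∀ θ : ℝ, ‖circleMap 0 1 θ‖ = 1 := fun θ => by simp [norm_circleMap_zero]
  let : MeasurableSpace E := borel E
  have : BorelSpace E := ⟨rfl⟩
  refine (intervalIntegral.hasFDerivAt_integral_of_dominated_of_fderiv_le (𝕜 := ℂ)
    (F := fun z θ => (circleMap 0 1 θ)⁻¹ * f (z + circleMap 0 1 θ • v))
    (F' := fun z θ => (circleMap 0 1 θ)⁻¹ • fderiv ℂ f (z + circleMap 0 1 θ • v))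
    (bound := fun _ => 2 * C / 1) (s := ball z₀ 1) (ball_mem_nhds _ one_pos)
    ?_ ?_ ?_ ?_ ?_ ?_).differentiableAt
  · refine Filter.Eventually.of_forall fun z => Continuous.aestronglyMeasurable ?_
    exact hcont.mul (hf.continuous.comp
      (continuous_const.add ((continuous_circleMap 0 1).smul continuous_const)))
  · refine Continuous.intervalIntegrable ?_ _ _
    exact hcont.mul (hf.continuous.comp
      (continuous_const.add ((continuous_circleMap 0 1).smul continuous_const)))
  · refine (hcont.measurable.smul ((measurable_fderiv ℂ f).comp
      (Continuous.measurable ?_))).aestronglyMeasurable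
    exact continuous_const.add ((continuous_circleMap 0 1).smul continuous_const)
  · refine Filter.Eventually.of_forall fun θ _ z hz => ?_
    rw [norm_smul, norm_inv, hn, inv_one, one_mul]
    refine norm_fderiv_le_of_norm_le_on_ball hf one_pos fun y hy => hC y ?_
    rw [mem_ball, dist_eq_norm] at hz hy
    rw [mem_closedBall, dist_eq_norm]
    have : y - z₀ = (y - (z + circleMap 0 1 θ • v)) + (z - z₀) + circleMap 0 1 θ • v := by abel
    rw [this]
    calc _ ≤ ‖y - (z + circleMap 0 1 θ • v)‖ + ‖z - z₀‖ + ‖circleMap 0 1 θ • v‖ := norm_add₃_le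
      _ ≤ 2 + ‖v‖ := by rw [norm_smul, hn, one_mul]; linarith
  · exact intervalIntegrable_const
  · refine Filter.Eventually.of_forall fun θ _ z hz => ?_
    have h1 : HasFDerivAt (fun z : E => z + circleMap 0 1 θ • v) (ContinuousLinearMap.id ℂ E) z :=
      (hasFDerivAt_id z).add_const _
    exact ((hf _).hasFDerivAt.comp z h1).const_mul _

/-- The homogeneous component of degree `l` of an entire function at the origin. -/
def taylorTerm (f : E → ℂ) (l : ℕ) (z : E) : ℂ :=
  (l.factorial : ℂ)⁻¹ * iteratedDeriv l (fun s : ℂ => f (s • z)) 0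

theorem differentiable_comp_smul {f : E → ℂ} (hf : Differentiable ℂ f) (z : E) :
    Differentiable ℂ fun s : ℂ => f (s • z) :=
  hf.comp (differentiable_id.smul_const z)

theorem hasSum_taylorTerm {f : E → ℂ} (hf : Differentiable ℂ f) (z : E) :
    HasSum (fun l => taylorTerm f l z) (f z) := by
  have := hasSum_taylorSeries_of_entire (differentiable_comp_smul hf z) 0 1
  simpa [taylorTerm] using this

theorem taylorTerm_eq_circle_average {f : E → ℂ} (hf : Differentiable ℂ f) (l : ℕ) (z : E) :
    taylorTerm f l z = (2 * Real.pi : ℂ)⁻¹ * ∫ θ in (0 : ℝ)..2 * Real.pi,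
      ((circleMap 0 1 θ)⁻¹) ^ l * f (circleMap 0 1 θ • z) :=
  iteratedDeriv_zero_eq_circle_average (differentiable_comp_smul hf z) l

end Entire

/-! ### Taylor components as homogeneous polynomials -/

section Homogeneous

variable {n : ℕ}

theorem coord_mul_mem_homogSpace {l : ℕ} {f : Cn n → ℂ} (hf : f ∈ homogSpace n l) (i : Fin n) :
    (fun z => z i * f z) ∈ homogSpace n (l + 1) := by
  obtain ⟨q, hq, rfl⟩ := hf
  refine ⟨MvPolynomial.X i * q, ?_, ?_⟩
  · have := (MvPolynomial.isHomogeneous_X ℂ i).mul hq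
    rw [add_comm] at this
    exact this
  · ext z; simp [polyEval]

/-- The Taylor components of an entire function are homogeneous polynomials, by induction on the
degree through `d/ds f (s z) = ∑ z_i (∂_i f) (s z)`. -/
theorem taylorTerm_mem_homogSpace (l : ℕ) {f : Cn n → ℂ} (hf : Differentiable ℂ f) :
    taylorTerm f l ∈ homogSpace n l := by
  suffices h : (fun z => iteratedDeriv l (fun s : ℂ => f (s • z)) 0) ∈ homogSpace n l from
    (homogSpace n l).smul_mem ((l.factorial : ℂ)⁻¹) h
  induction l generalizing f with
  | zero =>
    refine ⟨MvPolynomial.C (f 0), MvPolynomial.isHomogeneous_C _ _, ?_⟩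
    ext z; simp [polyEval]
  | succ l ih =>
    have key : (fun z : Cn n => iteratedDeriv (l + 1) (fun s : ℂ => f (s • z)) 0) =
        ∑ i, fun z : Cn n => z i *
          iteratedDeriv l (fun s : ℂ => fderiv ℂ f (s • z) (Pi.single i 1)) 0 := by
      ext z
      have hd : deriv (fun s : ℂ => f (s • z)) =
          fun s => ∑ i, z i * fderiv ℂ f (s • z) (Pi.single i 1) := by
        ext s
        have h2 : HasDerivAt (fun s : ℂ => s • z) z s := by
          simpa using (hasDerivAt_id s).smul_const z
        have h3 : HasDerivAt (fun s : ℂ => f (s • z)) (fderiv ℂ f (s • z) z) s :=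
          (hf _).hasFDerivAt.comp_hasDerivAt s h2
        have h4 : fderiv ℂ f (s • z) z =
            fderiv ℂ f (s • z) (∑ i, z i • (Pi.single i 1 : Cn n)) := by
          congr 1; ext i; simp [Finset.sum_apply, Pi.single_apply]
        rw [h3.deriv, h4, map_sum]
        simp
      rw [iteratedDeriv_succ', hd, iteratedDeriv_fun_sum, Finset.sum_apply]
      · simp
      · intro i _
        exact ((differentiable_comp_smul (differentiable_fderiv_apply hf _) z).const_mul
          (z i)).contDiff.contDiffAt
    rw [key]
    exact Submodule.sum_mem _ fun i _ =>
      coord_mul_mem_homogSpace (ih (differentiable_fderiv_apply hf _)) i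

end Homogeneous

/-! ### An integral representation of the Macdonald function -/

section Macdonald

open Set

theorem integrable_exp_mul_exp_neg_cosh (q : ℝ) {r : ℝ} (hr : 0 < r) :
    Integrable fun u : ℝ => Real.exp (q * u) * Real.exp (-(r * Real.cosh u)) := by
  -- since `u² / 4 ≤ cosh u`, completing the square bounds the integrand by a Gaussian
  have hb : 0 < r / 8 := by positivity
  refine ((integrable_exp_neg_mul_sq hb).const_mul (Real.exp (2 * q ^ 2 / r))).mono'
    (Continuous.aestronglyMeasurable (by fun_prop)) (Filter.Eventually.of_forall fun u => ?_)
  rw [Real.norm_of_nonneg (by positivity), ← Real.exp_add, ← Real.exp_add]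
  refine Real.exp_le_exp.2 ?_
  have h1 : u ^ 2 / 4 ≤ Real.cosh u := by
    have h2 := Real.quadratic_le_exp_of_nonneg (abs_nonneg u)
    rw [← Real.cosh_abs, Real.cosh_eq]
    have h3 : 1 - |u| ≤ Real.exp (-|u|) := by linarith [Real.add_one_le_exp (-|u|)]
    rw [sq_abs] at h2
    linarith
  have h2 : r * (u ^ 2 / 4) ≤ r * Real.cosh u := mul_le_mul_of_nonneg_left h1 hr.le
  have h3 : q * u ≤ 2 * q ^ 2 / r + r / 8 * u ^ 2 := by
    rw [← sub_nonneg]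
    have : 2 * q ^ 2 / r + r / 8 * u ^ 2 - q * u = 2 * (q - r / 4 * u) ^ 2 / r := by
      field_simp
      ring
    rw [this]; positivity
  linarith

theorem lintegral_Ioi_eq_lintegral_exp {r : ℝ} (hr : 0 < r) (g : ℝ → ENNReal) :
    ∫⁻ t in Ioi (0 : ℝ), g t =
      ∫⁻ u : ℝ, ENNReal.ofReal (r * Real.exp u) * g (r * Real.exp u) := by
  have himg : (fun u : ℝ => r * Real.exp u) '' univ = Ioi 0 := by
    ext t
    constructor
    · rintro ⟨u, -, rfl⟩
      exact mul_pos hr (Real.exp_pos u)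
    · intro ht
      refine ⟨Real.log (t / r), mem_univ _, ?_⟩
      have : 0 < t / r := div_pos ht hr
      simp only [Real.exp_log this]
      field_simp
  rw [← himg, lintegral_image_eq_lintegral_abs_deriv_mul MeasurableSet.univ
    (f' := fun u => r * Real.exp u)
    (fun u _ => ((Real.hasDerivAt_exp u).const_mul r).hasDerivWithinAt)
    (fun u _ v _ h => by simpa [hr.ne'] using h)]
  simp only [Measure.restrict_univ]
  exact lintegral_congr fun u => by rw [abs_of_pos (by positivity)]

/-- The representation `2 r^p K_p(2r) = ∫ t^(p-1) exp(-t - r²/t) dt`, obtained from the defining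
integral by `t = r exp u`. -/
theorem ofReal_macdonaldK (p : ℝ) {r : ℝ} (hr : 0 < r) :
    ENNReal.ofReal (2 * r ^ p * macdonaldK p (2 * r)) =
      ∫⁻ t in Ioi (0 : ℝ), ENNReal.ofReal (t ^ (p - 1) * Real.exp (-t - r ^ 2 / t)) := by
  set φ : ℝ → ℝ := fun u => r ^ p * (Real.exp (p * u) * Real.exp (-(2 * r * Real.cosh u)))
  have hφ0 : ∀ u, 0 ≤ φ u := fun u => by positivity
  have hφi : Integrable φ := (integrable_exp_mul_exp_neg_cosh p (by positivity)).const_mul _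
  have hpt : ∀ u : ℝ, r * Real.exp u * ((r * Real.exp u) ^ (p - 1) *
      Real.exp (-(r * Real.exp u) - r ^ 2 / (r * Real.exp u))) = φ u := by
    intro u
    have hpos : 0 < r * Real.exp u := by positivity
    have h1 : r * Real.exp u * (r * Real.exp u) ^ (p - 1) = r ^ p * Real.exp (p * u) := by
      rw [Real.rpow_sub_one hpos.ne', Real.mul_rpow hr.le (Real.exp_pos u).le, ← Real.exp_mul,
        mul_comm u p]
      field_simp
    have h2 : -(r * Real.exp u) - r ^ 2 / (r * Real.exp u) = -(2 * r * Real.cosh u) := by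
      rw [Real.cosh_eq, Real.exp_neg]
      field_simp
      ring
    rw [← mul_assoc, h1, h2, mul_assoc]
  rw [lintegral_Ioi_eq_lintegral_exp hr]
  simp_rw [← ENNReal.ofReal_mul (mul_pos hr (Real.exp_pos _)).le, hpt]
  rw [← ofReal_integral_eq_lintegral_ofReal hφi (Filter.Eventually.of_forall hφ0)]
  congr 1
  rw [← intervalIntegral.integral_Iic_add_Ioi hφi.integrableOn hφi.integrableOn (b := 0),
    show ∫ x in Iic (0 : ℝ), φ x = ∫ x in Ioi (0 : ℝ), φ (-x) by
      rw [integral_comp_neg_Ioi, neg_zero],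
    ← integral_add hφi.comp_neg.integrableOn hφi.integrableOn, macdonaldK,
    ← integral_const_mul]
  refine integral_congr_ae (Filter.Eventually.of_forall fun u => ?_)
  simp only [φ, Real.cosh_neg, Real.cosh_eq (p * u)]
  ring_nf

end Macdonald

/-! ### The Fock measure as a Gamma mixture of Gaussians -/

section Mixture

open Set

variable {n : ℕ}

/-- The joint density of the radial mixing parameter `t` and the point `z`: in `t` a Gamma weight,
in `z` a Gaussian of variance proportional to `t`. -/
def mixDensity (n : ℕ) (p ħ t : ℝ) (z : Cn n) : ℝ :=
  1 / Real.Gamma (n + p) * (1 / (Real.pi * ħ ^ 2) ^ n) * (t ^ (p - 1) * Real.exp (-t)) *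
    ∏ i, Real.exp (-(ħ ^ 2 * t)⁻¹ * ‖z i‖ ^ 2)

theorem measurable_mixDensity (n : ℕ) (p ħ : ℝ) :
    Measurable fun q : Cn n × ℝ => ENNReal.ofReal (mixDensity n p ħ q.2 q.1) := by
  unfold mixDensity
  fun_prop

theorem mixDensity_pos {p ħ : ℝ} (hp : -(n : ℝ) < p) (hħ : 0 < ħ) {t : ℝ} (ht : 0 < t)
    (z : Cn n) : 0 < mixDensity n p ħ t z := by
  have : 0 < Real.Gamma (n + p) := Real.Gamma_pos_of_pos (by linarith)
  have := Real.pi_pos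
  unfold mixDensity
  have := Real.rpow_pos_of_pos ht (p - 1)
  have : 0 < ∏ i, Real.exp (-(ħ ^ 2 * t)⁻¹ * ‖z i‖ ^ 2) :=
    Finset.prod_pos fun i _ => Real.exp_pos _
  positivity

theorem len_sq (z : Cn n) : len z ^ 2 = ∑ l, ‖z l‖ ^ 2 :=
  Real.sq_sqrt (Finset.sum_nonneg fun l _ => by positivity)

theorem len_pos {z : Cn n} (hz : z ≠ 0) : 0 < len z := by
  obtain ⟨i, hi⟩ := Function.ne_iff.1 hz
  refine Real.sqrt_pos.2 (Finset.sum_pos' (fun l _ => by positivity) ⟨i, Finset.mem_univ i, ?_⟩)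
  have : 0 < ‖z i‖ := norm_pos_iff.2 hi
  positivity

theorem fockMeasure_eq (hn : 1 ≤ n) {p ħ : ℝ} (hp : -(n : ℝ) < p) (hħ : 0 < ħ) :
    fockMeasure n p ħ = volume.withDensity fun z =>
      ∫⁻ t in Ioi (0 : ℝ), ENNReal.ofReal (mixDensity n p ħ t z) := by
  have : Nonempty (Fin n) := ⟨⟨0, hn⟩⟩
  have hne : ∀ᵐ z : Cn n, z ≠ 0 := by
    rw [ae_iff]
    simp
  refine withDensity_congr_ae ?_
  filter_upwards [hne] with z hz
  have hr : 0 < len z / ħ := div_pos (len_pos hz) hħ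
  have hΓ : 0 < Real.Gamma (n + p) := Real.Gamma_pos_of_pos (by linarith)
  have hc : 0 ≤ 1 / Real.Gamma (n + p) * (1 / (Real.pi * ħ ^ 2) ^ n) := by positivity
  have h1 : 1 / Real.Gamma (n + p) * (2 / (Real.pi * ħ ^ 2) ^ n) * (len z / ħ) ^ p *
      macdonaldK p (2 * (len z / ħ)) = 1 / Real.Gamma (n + p) * (1 / (Real.pi * ħ ^ 2) ^ n) *
        (2 * (len z / ħ) ^ p * macdonaldK p (2 * (len z / ħ))) := by ring
  rw [h1, ENNReal.ofReal_mul hc, ofReal_macdonaldK p hr, ← lintegral_const_mul' _ _ (by simp)]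
  refine setLIntegral_congr_fun measurableSet_Ioi fun t ht => ?_
  have ht0 : t ≠ 0 := (mem_Ioi.1 ht).ne'
  rw [← ENNReal.ofReal_mul hc, mixDensity, ← Real.exp_sum, ← Finset.mul_sum, ← len_sq]
  congr 1
  have : -t - (len z / ħ) ^ 2 / t = -t + -(ħ ^ 2 * t)⁻¹ * len z ^ 2 := by
    field_simp
    ring
  rw [this, Real.exp_add]
  ring

theorem measurable_mixture (n : ℕ) (p ħ : ℝ) : Measurable fun z : Cn n =>
    ∫⁻ t in Ioi (0 : ℝ), ENNReal.ofReal (mixDensity n p ħ t z) :=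
  (measurable_mixDensity n p ħ).lintegral_prod_right'

/-- Integration against the Fock measure is a Gamma mixture of Gaussian integrals. -/
theorem lintegral_fockMeasure (hn : 1 ≤ n) {p ħ : ℝ} (hp : -(n : ℝ) < p) (hħ : 0 < ħ)
    {h : Cn n → ENNReal} (hh : Measurable h) :
    ∫⁻ z, h z ∂fockMeasure n p ħ =
      ∫⁻ t in Ioi (0 : ℝ), ∫⁻ z, ENNReal.ofReal (mixDensity n p ħ t z) * h z := by
  rw [fockMeasure_eq hn hp hħ, lintegral_withDensity_eq_lintegral_mul _
    (measurable_mixture n p ħ) hh, lintegral_lintegral_swap]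
  · refine lintegral_congr fun z => ?_
    rw [Pi.mul_apply, lintegral_mul_const]
    exact (measurable_mixDensity n p ħ).comp (measurable_const.prodMk measurable_id)
  · refine Measurable.aemeasurable ?_
    exact ((measurable_mixDensity n p ħ).comp measurable_swap).mul (hh.comp measurable_snd)

theorem volume_absolutelyContinuous_fockMeasure (hn : 1 ≤ n) {p ħ : ℝ} (hp : -(n : ℝ) < p)
    (hħ : 0 < ħ) : (volume : Measure (Cn n)) ≪ fockMeasure n p ħ := by
  rw [fockMeasure_eq hn hp hħ]
  refine withDensity_absolutelyContinuous' (measurable_mixture n p ħ).aemeasurable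
    (Filter.Eventually.of_forall fun z h0 => ?_)
  have hm : Measurable fun t : ℝ => ENNReal.ofReal (mixDensity n p ħ t z) :=
    (measurable_mixDensity n p ħ).comp (measurable_const.prodMk measurable_id)
  rw [setLIntegral_eq_zero_iff measurableSet_Ioi hm] at h0
  have h1 : ∀ᵐ t : ℝ, t ∉ Ioi (0 : ℝ) := by
    filter_upwards [h0] with t ht hpos
    have := ht hpos
    rw [ENNReal.ofReal_eq_zero] at this
    exact absurd (mixDensity_pos hp hħ hpos z) (not_lt.2 this)
  have h2 : volume (Ioi (0 : ℝ)) = 0 := measure_eq_zero_iff_ae_notMem.2 h1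
  rw [Real.volume_Ioi] at h2
  exact ENNReal.top_ne_zero h2

theorem integral_norm_pow_mul_exp (k : ℕ) {b : ℝ} (hb : 0 < b) :
    ∫ z : ℂ, ‖z‖ ^ (2 * k) * Real.exp (-b * ‖z‖ ^ 2) =
      Real.pi * b⁻¹ ^ (k + 1) * k.factorial := by
  have h := Complex.integral_rpow_mul_exp_neg_mul_rpow (p := 2) (q := (2 * k : ℕ)) one_le_two
    (lt_of_lt_of_le (by norm_num) (Nat.cast_nonneg _)) hb
  have e1 : (((2 * k : ℕ) : ℝ) + 2) / 2 = k + 1 := by push_cast; ring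
  have e2 : -(((2 * k : ℕ) : ℝ) + 2) / 2 = -((k + 1 : ℕ) : ℝ) := by push_cast; ring
  rw [e1, e2, Real.Gamma_nat_eq_factorial, Real.rpow_neg hb.le, Real.rpow_natCast,
    ← inv_pow] at h
  simp only [Real.rpow_natCast, Real.rpow_ofNat] at h
  rw [h]; ring

theorem integrable_norm_pow_mul_exp (k : ℕ) {b : ℝ} (hb : 0 < b) :
    Integrable fun z : ℂ => ‖z‖ ^ (2 * k) * Real.exp (-b * ‖z‖ ^ 2) := by
  -- a function that is not integrable would have Bochner integral `0`
  by_contra hni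
  have h := integral_norm_pow_mul_exp k hb
  rw [integral_undef hni] at h
  have := Real.pi_pos
  have : 0 < Real.pi * b⁻¹ ^ (k + 1) * k.factorial := by positivity
  linarith

theorem lintegral_monomial_mul_gaussian (k : Fin n → ℕ) {b : ℝ} (hb : 0 < b) :
    ∫⁻ z : Cn n, ENNReal.ofReal (∏ i, ‖z i‖ ^ (2 * k i) * Real.exp (-b * ‖z i‖ ^ 2)) =
      ENNReal.ofReal (∏ i, Real.pi * b⁻¹ ^ (k i + 1) * (k i).factorial) := by
  rw [← ofReal_integral_eq_lintegral_ofReal]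
  · rw [integral_fintype_prod_volume_eq_prod
      (fun i (z : ℂ) => ‖z‖ ^ (2 * k i) * Real.exp (-b * ‖z‖ ^ 2))]
    simp only [integral_norm_pow_mul_exp _ hb]
  · exact Integrable.fintype_prod (f := fun i (z : ℂ) => ‖z‖ ^ (2 * k i) * Real.exp (-b * ‖z‖ ^ 2))
      fun i => integrable_norm_pow_mul_exp (k i) hb
  · exact Filter.Eventually.of_forall fun z => Finset.prod_nonneg fun i _ => by positivity

theorem poch_pos {b : ℝ} (hb : 0 < b) (l : ℕ) : 0 < poch b l :=
  div_pos (Real.Gamma_pos_of_pos (by positivity)) (Real.Gamma_pos_of_pos hb)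

/-- The squared norm of `z^k`: a Gaussian moment for fixed `t`, then a Gamma integral over `t`. -/
theorem lintegral_monomial (hn : 1 ≤ n) {p ħ : ℝ} (hp : -(n : ℝ) < p) (hħ : 0 < ħ)
    (k : Fin n → ℕ) :
    ∫⁻ z, ENNReal.ofReal (∏ i, ‖z i‖ ^ (2 * k i)) ∂fockMeasure n p ħ =
      ENNReal.ofReal ((ħ ^ (∑ i, k i)) ^ 2 *
        (poch (n + p) (∑ i, k i) * ∏ i, ((k i).factorial : ℝ))) := by
  have hΓ : 0 < Real.Gamma (n + p) := Real.Gamma_pos_of_pos (by linarith)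
  have hpi := Real.pi_pos
  set C : ℝ := 1 / Real.Gamma (n + p) * ((ħ ^ (∑ i, k i)) ^ 2 * ∏ i, ((k i).factorial : ℝ))
  have hC : 0 ≤ C := by positivity
  have hb : 0 < n + p + (∑ i, k i : ℕ) := by
    have : (0 : ℝ) ≤ (∑ i, k i : ℕ) := Nat.cast_nonneg _
    linarith
  rw [lintegral_fockMeasure hn hp hħ (by fun_prop)]
  have key : ∀ t ∈ Ioi (0 : ℝ), ∫⁻ z : Cn n, ENNReal.ofReal (mixDensity n p ħ t z) *
      ENNReal.ofReal (∏ i, ‖z i‖ ^ (2 * k i)) =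
      ENNReal.ofReal (C * (Real.exp (-t) * t ^ (n + p + (∑ i, k i : ℕ) - 1))) := by
    intro t ht
    have ht : 0 < t := ht
    have hbt : 0 < (ħ ^ 2 * t)⁻¹ := by positivity
    set A : ℝ := 1 / Real.Gamma (n + p) * (1 / (Real.pi * ħ ^ 2) ^ n) *
      (t ^ (p - 1) * Real.exp (-t)) with hA
    have hA0 : 0 ≤ A := by positivity
    have h1 : ∀ z : Cn n, ENNReal.ofReal (mixDensity n p ħ t z) *
        ENNReal.ofReal (∏ i, ‖z i‖ ^ (2 * k i)) = ENNReal.ofReal A * ENNReal.ofReal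
          (∏ i, ‖z i‖ ^ (2 * k i) * Real.exp (-(ħ ^ 2 * t)⁻¹ * ‖z i‖ ^ 2)) := by
      intro z
      rw [← ENNReal.ofReal_mul (mixDensity_pos hp hħ ht z).le, ← ENNReal.ofReal_mul hA0,
        Finset.prod_mul_distrib, mixDensity]
      congr 1; ring
    simp_rw [h1]
    rw [lintegral_const_mul' _ _ (by simp), lintegral_monomial_mul_gaussian k hbt,
      ← ENNReal.ofReal_mul hA0]
    congr 1
    have h2 : t ^ (n + p + (∑ i, k i : ℕ) - 1) = t ^ n * t ^ (∑ i, k i) * t ^ (p - 1) := by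
      rw [← Real.rpow_natCast, ← Real.rpow_natCast t, ← Real.rpow_add ht, ← Real.rpow_add ht]
      congr 1; ring
    rw [h2, hA, inv_inv]
    simp only [C, Finset.prod_mul_distrib, Finset.prod_const, Finset.card_univ, Fintype.card_fin,
      Finset.prod_pow_eq_pow_sum, pow_add, mul_pow, pow_one]
    field_simp
    ring
  rw [setLIntegral_congr_fun measurableSet_Ioi key, ← ofReal_integral_eq_lintegral_ofReal]
  · rw [integral_const_mul, ← Real.Gamma_eq_integral hb]
    congr 1
    simp only [C, poch]; field_simp
  · exact (Real.GammaIntegral_convergent hb).const_mul C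
  · refine (ae_restrict_mem measurableSet_Ioi).mono fun t ht => ?_
    have : 0 < t := ht
    positivity

end Mixture

/-! ### Torus invariance -/

section Rotation
variable {n : ℕ}

/-- The Fock measure is invariant under the action of the torus on coordinates. -/
theorem measurePreserving_torus (hn : 1 ≤ n) {p ħ : ℝ} (hp : -(n : ℝ) < p) (hħ : 0 < ħ)
    (c : Fin n → ℂ) (hc : ∀ i, ‖c i‖ = 1) :
    MeasurePreserving (fun (z : Cn n) i => c i * z i) (fockMeasure n p ħ) (fockMeasure n p ħ) := by
  have hv : MeasurePreserving (fun (z : Cn n) i => c i * z i) volume volume := by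
    refine volume_preserving_pi (f := fun i (x : ℂ) => c i * x) fun i => ?_
    have := (rotation (⟨c i, by simp [Submonoid.unitSphere, hc i]⟩ : Circle)).measurePreserving
    exact this
  refine ⟨hv.measurable, ?_⟩
  ext s hs
  rw [Measure.map_apply hv.measurable hs, fockMeasure_eq hn hp hħ, withDensity_apply _ hs,
    withDensity_apply _ (hv.measurable hs),
    ← hv.setLIntegral_comp_preimage hs (measurable_mixture n p ħ)]
  refine lintegral_congr fun z => ?_
  simp [mixDensity, hc]

end Rotation

/-! ### Polynomials and orthonormality of the monomials -/

section Polynomials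
variable {n : ℕ} (p ħ : ℝ)

/-- The real factor of `normMonomial`. -/
def monomialCoeff (p ħ : ℝ) (k : Fin n → ℕ) : ℝ :=
  1 / ħ ^ (∑ i, k i) * Real.sqrt (1 / (poch (n + p) (∑ i, k i) * ∏ i, ((k i).factorial : ℝ)))

theorem normMonomial_apply (k : Fin n → ℕ) (z : Cn n) :
    normMonomial p ħ k z = (monomialCoeff p ħ k : ℂ) * ∏ i, z i ^ k i := rfl

variable {p ħ}

theorem monomialCoeff_sq (hp : -(n : ℝ) < p) (k : Fin n → ℕ) :
    monomialCoeff p ħ k ^ 2 = ((ħ ^ (∑ i, k i)) ^ 2 *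
      (poch (n + p) (∑ i, k i) * ∏ i, ((k i).factorial : ℝ)))⁻¹ := by
  have := poch_pos (b := n + p) (by linarith) (∑ i, k i)
  rw [monomialCoeff, mul_pow, Real.sq_sqrt (by positivity), div_pow, one_pow, mul_inv,
    one_div, one_div, mul_inv]

theorem monomialCoeff_pos (hp : -(n : ℝ) < p) (hħ : 0 < ħ) (k : Fin n → ℕ) :
    0 < monomialCoeff p ħ k := by
  have := poch_pos (b := n + p) (by linarith) (∑ i, k i)
  unfold monomialCoeff
  positivity

theorem normMonomial_mem_homogSpace (k : Fin n → ℕ) :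
    normMonomial p ħ k ∈ homogSpace n (∑ i, k i) := by
  refine ⟨(monomialCoeff p ħ k : ℂ) • ∏ i, MvPolynomial.X i ^ k i, ?_, ?_⟩
  · refine Submodule.smul_mem _ _ (MvPolynomial.IsHomogeneous.prod _ _ _ fun i _ => ?_)
    simpa using (MvPolynomial.isHomogeneous_X ℂ i).pow (k i)
  · ext z
    simp [polyEval, normMonomial_apply]

theorem homogSpace_le_polySpace (l : ℕ) : homogSpace n l ≤ polySpace n :=
  LinearMap.map_le_range

theorem polyEval_eq_sum (hp : -(n : ℝ) < p) (hħ : 0 < ħ) (q : MvPolynomial (Fin n) ℂ) :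
    polyEval n q = ∑ d ∈ q.support,
      (q.coeff d * (monomialCoeff p ħ d : ℂ)⁻¹) • normMonomial p ħ d := by
  ext z
  have hc : ∀ d : Fin n →₀ ℕ, (monomialCoeff p ħ d : ℂ) ≠ 0 := fun d =>
    by exact_mod_cast (monomialCoeff_pos hp hħ d).ne'
  simp only [polyEval, LinearMap.coe_mk, AddHom.coe_mk, MvPolynomial.eval_eq', Finset.sum_apply,
    Pi.smul_apply, smul_eq_mul, normMonomial_apply]
  refine Finset.sum_congr rfl fun d _ => ?_
  have := hc d
  field_simp

theorem sum_eq_of_mem_support {l : ℕ} {q : MvPolynomial (Fin n) ℂ}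
    (hq : q ∈ MvPolynomial.homogeneousSubmodule (Fin n) ℂ l) {d : Fin n →₀ ℕ}
    (hd : d ∈ q.support) : ∑ i, d i = l := by
  have := (MvPolynomial.mem_homogeneousSubmodule _ _).1 hq (MvPolynomial.mem_support_iff.1 hd)
  rwa [Pi.one_def, ← Finsupp.degree_eq_weight_one, Finsupp.degree_eq_sum] at this

theorem homogSpace_eq_span (hp : -(n : ℝ) < p) (hħ : 0 < ħ) (l : ℕ) :
    homogSpace n l =
      Submodule.span ℂ (normMonomial p ħ '' {k : Fin n → ℕ | ∑ i, k i = l}) := by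
  apply le_antisymm
  · rintro _ ⟨q, hq, rfl⟩
    rw [polyEval_eq_sum hp hħ]
    exact Submodule.sum_mem _ fun d hd => Submodule.smul_mem _ _
      (Submodule.subset_span ⟨d, sum_eq_of_mem_support hq hd, rfl⟩)
  · rw [Submodule.span_le]
    rintro _ ⟨k, rfl, rfl⟩
    exact normMonomial_mem_homogSpace k

theorem polySpace_eq_span (hp : -(n : ℝ) < p) (hħ : 0 < ħ) :
    polySpace n = Submodule.span ℂ (Set.range (normMonomial (n := n) p ħ)) := by
  apply le_antisymm
  · rintro _ ⟨q, rfl⟩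
    rw [polyEval_eq_sum hp hħ]
    exact Submodule.sum_mem _ fun d _ => Submodule.smul_mem _ _ (Submodule.subset_span ⟨d, rfl⟩)
  · rw [Submodule.span_le]
    rintro _ ⟨k, rfl⟩
    exact homogSpace_le_polySpace _ (normMonomial_mem_homogSpace k)

theorem apply_smul_of_mem_homogSpace {l : ℕ} {f : Cn n → ℂ} (hf : f ∈ homogSpace n l) (c : ℂ)
    (z : Cn n) : f (c • z) = c ^ l * f z := by
  obtain ⟨q, hq, rfl⟩ := hf
  simp only [polyEval, LinearMap.coe_mk, AddHom.coe_mk, MvPolynomial.eval_eq', Finset.mul_sum]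
  refine Finset.sum_congr rfl fun d hd => ?_
  simp only [Pi.smul_apply, smul_eq_mul, mul_pow, Finset.prod_mul_distrib,
    Finset.prod_pow_eq_pow_sum, sum_eq_of_mem_support hq hd]
  ring

theorem integrable_normSq_monomial (hn : 1 ≤ n) (hp : -(n : ℝ) < p) (hħ : 0 < ħ)
    (k : Fin n → ℕ) :
    Integrable (fun z : Cn n => ∏ i, ‖z i‖ ^ (2 * k i)) (fockMeasure n p ħ) := by
  refine ⟨Continuous.aestronglyMeasurable (by fun_prop), ?_⟩
  rw [hasFiniteIntegral_iff_ofReal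
    (Filter.Eventually.of_forall fun z => Finset.prod_nonneg fun i _ => by positivity),
    lintegral_monomial hn hp hħ]
  exact ENNReal.ofReal_lt_top

theorem isFiniteMeasure_fockMeasure (hn : 1 ≤ n) (hp : -(n : ℝ) < p) (hħ : 0 < ħ) :
    IsFiniteMeasure (fockMeasure n p ħ) := by
  have h := integrable_normSq_monomial hn hp hħ 0
  simp only [Pi.zero_apply, mul_zero, pow_zero, Finset.prod_const_one] at h
  exact (integrable_const_iff_isFiniteMeasure one_ne_zero).1 h

theorem differentiable_normMonomial (k : Fin n → ℕ) :
    Differentiable ℂ (normMonomial p ħ k) := by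
  have h : ∀ s : Finset (Fin n), Differentiable ℂ fun z : Cn n => ∏ i ∈ s, z i ^ k i := by
    intro s
    induction s using Finset.induction_on with
    | empty => simp
    | insert i s hi ih =>
      simp only [Finset.prod_insert hi]
      exact Differentiable.mul (by fun_prop) ih
  exact (h Finset.univ).const_mul (monomialCoeff p ħ k : ℂ)

theorem normMonomial_mem_entireSpace (hn : 1 ≤ n) (hp : -(n : ℝ) < p) (hħ : 0 < ħ)
    (k : Fin n → ℕ) : normMonomial p ħ k ∈ entireSpace n p ħ := by
  refine ⟨differentiable_normMonomial k, ?_⟩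
  rw [memLp_two_iff_integrable_sq_norm
    (differentiable_normMonomial k).continuous.aestronglyMeasurable]
  refine ((integrable_normSq_monomial hn hp hħ k).const_mul (monomialCoeff p ħ k ^ 2)).congr
    (Filter.Eventually.of_forall fun z => ?_)
  simp only [normMonomial_apply, norm_mul, norm_prod, norm_pow, Complex.norm_real, mul_pow,
    Real.norm_eq_abs, sq_abs, ← Finset.prod_pow, ← pow_mul, mul_comm 2]

theorem polySpace_le_entireSpace (hn : 1 ≤ n) (hp : -(n : ℝ) < p) (hħ : 0 < ħ) :
    polySpace n ≤ entireSpace n p ħ := by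
  rw [polySpace_eq_span hp hħ, Submodule.span_le]
  rintro _ ⟨k, rfl⟩
  exact normMonomial_mem_entireSpace hn hp hħ k

theorem homogSpace_le_entireSpace (hn : 1 ≤ n) (hp : -(n : ℝ) < p) (hħ : 0 < ħ) (l : ℕ) :
    homogSpace n l ≤ entireSpace n p ħ :=
  (homogSpace_le_polySpace l).trans (polySpace_le_entireSpace hn hp hħ)

/-- Distinct monomials are orthogonal because rotating one coordinate by a suitable angle changes
the sign of the integral. -/
theorem integral_normMonomial_mul_conj (hn : 1 ≤ n) (hp : -(n : ℝ) < p) (hħ : 0 < ħ)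
    (k m : Fin n → ℕ) :
    ∫ z, normMonomial p ħ k z * conj (normMonomial p ħ m z) ∂fockMeasure n p ħ =
      if k = m then 1 else 0 := by
  split_ifs with h
  · subst h
    have h1 : ∀ z : Cn n, normMonomial p ħ k z * conj (normMonomial p ħ k z) =
        ((monomialCoeff p ħ k ^ 2 * ∏ i, ‖z i‖ ^ (2 * k i) : ℝ) : ℂ) := by
      intro z
      rw [Complex.mul_conj, Complex.normSq_eq_norm_sq]
      simp only [normMonomial_apply, norm_mul, norm_prod, norm_pow, Complex.norm_real, mul_pow,
        Real.norm_eq_abs, sq_abs, ← Finset.prod_pow, ← pow_mul, mul_comm 2]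
    simp only [h1]
    have hpoch := poch_pos (b := n + p) (by linarith) (∑ i, k i)
    rw [integral_complex_ofReal, integral_const_mul, monomialCoeff_sq hp,
      integral_eq_lintegral_of_nonneg_ae
        (Filter.Eventually.of_forall fun z => Finset.prod_nonneg fun i _ => by positivity)
        (Continuous.aestronglyMeasurable (by fun_prop)),
      lintegral_monomial hn hp hħ, ENNReal.toReal_ofReal (by positivity),
      inv_mul_cancel₀ (by positivity), Complex.ofReal_one]
  · obtain ⟨j, hj⟩ := Function.ne_iff.1 h
    -- rotation of the `j`-th coordinate by `π / d` multiplies the integrand by `exp (iπ) = -1`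
    set d : ℝ := (k j : ℝ) - m j
    have hd : d ≠ 0 := sub_ne_zero.2 (by exact_mod_cast hj)
    set u : ℂ := Complex.exp ((Real.pi / d : ℝ) * Complex.I)
    set c : Fin n → ℂ := Function.update 1 j u
    have hu : ‖u‖ = 1 := Complex.norm_exp_ofReal_mul_I _
    have hc : ∀ i, ‖c i‖ = 1 := by
      intro i
      by_cases hi : i = j
      · subst hi; simp [c, hu]
      · simp [c, hi]
    have hT := measurePreserving_torus hn hp hħ c hc
    have hmono : ∀ (a : Fin n → ℕ) (z : Cn n),
        normMonomial p ħ a (fun i => c i * z i) = u ^ a j * normMonomial p ħ a z := by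
      intro a z
      simp only [normMonomial_apply, mul_pow, Finset.prod_mul_distrib]
      have : ∏ i, c i ^ a i = u ^ a j := by
        rw [Finset.prod_eq_single j]
        · simp [c]
        · intro i _ hi; simp [c, hi]
        · simp
      rw [this]; ring
    have hsign : u ^ k j * conj (u ^ m j) = -1 := by
      rw [map_pow, ← Complex.exp_conj, ← Complex.exp_nat_mul, ← Complex.exp_nat_mul,
        ← Complex.exp_add, ← Complex.exp_pi_mul_I]
      congr 1
      have hd' : (d : ℂ) ≠ 0 := by exact_mod_cast hd
      have hdc : (d : ℂ) = (k j : ℂ) - m j := by simp [d]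
      simp only [map_mul, Complex.conj_ofReal, Complex.conj_I]
      rw [Complex.ofReal_div]
      field_simp
      rw [hdc]; ring
    set g : Cn n → ℂ := fun z => normMonomial p ħ k z * conj (normMonomial p ħ m z)
    have hg : Continuous g := (differentiable_normMonomial k).continuous.mul
      (Complex.continuous_conj.comp (differentiable_normMonomial m).continuous)
    have h1 : ∫ z, g z ∂fockMeasure n p ħ = -∫ z, g z ∂fockMeasure n p ħ := by
      conv_lhs => rw [← hT.map_eq]
      rw [integral_map hT.aemeasurable hg.aestronglyMeasurable, ← integral_neg]
      refine integral_congr_ae (Filter.Eventually.of_forall fun z => ?_)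
      simp only [g, hmono, map_mul]
      linear_combination (normMonomial p ħ k z * conj (normMonomial p ħ m z)) * hsign
    exact self_eq_neg.1 h1

end Polynomials

/-! ### The kernel as a power series -/

section KernelSeries
variable {n : ℕ} {p ħ : ℝ}

theorem dot_comm_conj (z w : Cn n) : conj (dot z w) = dot w z := by
  simp [dot, mul_comm]

theorem conj_kernelPart (l : ℕ) (z w : Cn n) :
    conj (kernelPart n p ħ l z w) = kernelPart n p ħ l w z := by
  simp [kernelPart, dot_comm_conj]

/-- The kernel of the homogeneous polynomials, expanded by the multinomial theorem. -/
theorem kernelPart_eq_sum (hp : -(n : ℝ) < p) (hħ : 0 < ħ) (l : ℕ) (z w : Cn n) :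
    kernelPart n p ħ l z w = ∑ k ∈ Finset.piAntidiag (Finset.univ : Finset (Fin n)) l,
      normMonomial p ħ k z * conj (normMonomial p ħ k w) := by
  rw [kernelPart, div_pow, dot, Finset.sum_pow_eq_sum_piAntidiag, Finset.sum_div, Finset.mul_sum]
  refine Finset.sum_congr rfl fun k hk => ?_
  have hk : ∑ i, k i = l := (Finset.mem_piAntidiag.1 hk).1
  have hpoch := poch_pos (b := n + p) (by linarith) l
  have hC : (monomialCoeff p ħ k : ℂ) ^ 2 =
      (((ħ ^ l) ^ 2 * (poch (n + p) l * ∏ i, ((k i).factorial : ℝ)))⁻¹ : ℝ) := by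
    rw [← Complex.ofReal_pow, monomialCoeff_sq hp, hk]
  have hm : ((∏ i, ((k i).factorial : ℂ)) * (Nat.multinomial Finset.univ k : ℂ)) =
      (l.factorial : ℂ) := by
    rw [← hk]; exact_mod_cast Nat.multinomial_spec Finset.univ k
  have hf : (∏ i, ((k i).factorial : ℂ)) ≠ 0 :=
    Finset.prod_ne_zero_iff.2 fun i _ => by exact_mod_cast (k i).factorial_ne_zero
  have hmn : (Nat.multinomial Finset.univ k : ℂ) ≠ 0 := by
    intro h0
    rw [h0, mul_zero] at hm
    exact l.factorial_ne_zero (by exact_mod_cast hm.symm)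
  have hh : (ħ : ℂ) ≠ 0 := by exact_mod_cast hħ.ne'
  have hq : (poch (n + p) l : ℂ) ≠ 0 := by exact_mod_cast hpoch.ne'
  simp only [normMonomial_apply, map_mul, map_prod, map_pow, Complex.conj_ofReal, mul_pow,
    Finset.prod_mul_distrib]
  rw [show ∀ a x y : ℂ, a * x * (a * y) = a ^ 2 * (x * y) by intros; ring, hC, ← hm]
  push_cast
  field_simp
  ring

theorem kernelPart_mem_homogSpace (hp : -(n : ℝ) < p) (hħ : 0 < ħ) (l : ℕ) (z : Cn n) :
    (fun w => kernelPart n p ħ l w z) ∈ homogSpace n l := by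
  have : (fun w => kernelPart n p ħ l w z) =
      ∑ k ∈ Finset.piAntidiag (Finset.univ : Finset (Fin n)) l,
        conj (normMonomial p ħ k z) • normMonomial p ħ k := by
    ext w
    simp [kernelPart_eq_sum hp hħ, Finset.sum_apply, mul_comm]
  rw [this]
  refine Submodule.sum_mem _ fun k hk => Submodule.smul_mem _ _ ?_
  rw [← (Finset.mem_piAntidiag.1 hk).1]
  exact normMonomial_mem_homogSpace k

/-- The size `R^l / (l! (b)_l)` of the terms of the kernel series. -/
def kernelBound (b R : ℝ) (l : ℕ) : ℝ := R ^ l / (l.factorial * poch b l)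

theorem poch_succ {b : ℝ} (hb : 0 < b) (l : ℕ) : poch b (l + 1) = (b + l) * poch b l := by
  rw [poch, poch, Nat.cast_succ, ← add_assoc, Real.Gamma_add_one (by positivity)]
  ring

theorem min_one_le_poch {b : ℝ} (hb : 0 < b) (l : ℕ) : min b 1 ≤ poch b l := by
  have h0 : poch b 0 = 1 := by
    simp [poch, (Real.Gamma_pos_of_pos hb).ne']
  induction l with
  | zero => rw [h0]; exact min_le_right _ _
  | succ l ih =>
    rcases Nat.eq_zero_or_pos l with rfl | hl
    · rw [poch_succ hb, h0]; simp
    · rw [poch_succ hb]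
      have : (1 : ℝ) ≤ l := by exact_mod_cast hl
      nlinarith [poch_pos hb l]

theorem kernelBound_nonneg {b R : ℝ} (hb : 0 < b) (hR : 0 ≤ R) (l : ℕ) :
    0 ≤ kernelBound b R l := by
  have := poch_pos hb l
  unfold kernelBound
  positivity

theorem kernelBound_mono {b R R' : ℝ} (hb : 0 < b) (hR : 0 ≤ R) (h : R ≤ R') (l : ℕ) :
    kernelBound b R l ≤ kernelBound b R' l := by
  have := poch_pos hb l
  unfold kernelBound
  gcongr

theorem summable_kernelBound {b R : ℝ} (hb : 0 < b) (hR : 0 ≤ R) :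
    Summable (kernelBound b R) := by
  have hc : 0 < min b 1 := lt_min hb one_pos
  refine Summable.of_nonneg_of_le (kernelBound_nonneg hb hR) (fun l => ?_)
    ((Real.summable_pow_div_factorial R).mul_left (min b 1)⁻¹)
  rw [kernelBound, ← div_div, div_eq_inv_mul]
  exact mul_le_mul_of_nonneg_right (inv_anti₀ hc (min_one_le_poch hb l)) (by positivity)

theorem summable_sqrt_kernelBound {b R : ℝ} (hb : 0 < b) (hR : 0 ≤ R) :
    Summable fun l => Real.sqrt (kernelBound b R l) := by
  refine Summable.of_nonneg_of_le (fun l => Real.sqrt_nonneg _) (fun l => ?_)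
    ((summable_kernelBound hb (mul_nonneg zero_le_four hR)).add
      (summable_geometric_of_lt_one (r := 1 / 4) (by norm_num) (by norm_num)))
  -- the geometric mean of the two summands is the left-hand side
  have h : kernelBound b R l = kernelBound b (4 * R) l * (1 / 4) ^ l := by
    unfold kernelBound
    rw [mul_pow, one_div, inv_pow]
    field_simp
  have h4 := kernelBound_nonneg hb (mul_nonneg zero_le_four hR) l
  rw [Real.sqrt_le_left (by positivity), h]
  nlinarith [mul_nonneg h4 (by positivity : (0 : ℝ) ≤ (1 / 4) ^ l), sq_nonneg
    (kernelBound b (4 * R) l), sq_nonneg ((1 / 4 : ℝ) ^ l)]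

/-- The entire function of one variable through which the kernel factors:
`kernel z w = kernelProfile (z · w)`. -/
def kernelProfile (b ħ : ℝ) (s : ℂ) : ℂ :=
  ∑' l : ℕ, 1 / ((l.factorial : ℂ) * (poch b l : ℂ)) * (s / (ħ : ℂ) ^ 2) ^ l

theorem norm_kernelProfile_term {b ħ : ℝ} (hb : 0 < b) (s : ℂ) (l : ℕ) :
    ‖1 / ((l.factorial : ℂ) * (poch b l : ℂ)) * (s / (ħ : ℂ) ^ 2) ^ l‖ =
      kernelBound b (‖s‖ / ħ ^ 2) l := by
  have := poch_pos hb l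
  simp only [norm_mul, norm_div, norm_pow, norm_one, Complex.norm_natCast, Complex.norm_real,
    Real.norm_eq_abs, abs_of_pos this, sq_abs, kernelBound]
  ring

theorem hasSum_kernelProfile {b ħ : ℝ} (hb : 0 < b) (s : ℂ) :
    HasSum (fun l : ℕ => 1 / ((l.factorial : ℂ) * (poch b l : ℂ)) * (s / (ħ : ℂ) ^ 2) ^ l)
      (kernelProfile b ħ s) := by
  refine Summable.hasSum (Summable.of_norm ?_)
  simp only [norm_kernelProfile_term hb]
  exact summable_kernelBound hb (by positivity)

theorem differentiable_kernelProfile {b : ℝ} (hb : 0 < b) (ħ : ℝ) :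
    Differentiable ℂ (kernelProfile b ħ) := by
  refine differentiable_tsum_of_norm_le_on_ball (fun l => by fun_prop) fun x =>
    ⟨kernelBound b ((‖x‖ + 2) / ħ ^ 2), summable_kernelBound hb (by positivity), fun l y hy => ?_⟩
  rw [norm_kernelProfile_term hb]
  refine kernelBound_mono hb (by positivity) ?_ l
  have : ‖y‖ ≤ ‖x‖ + 2 := by
    rw [mem_ball_iff_norm] at hy
    linarith [norm_le_norm_add_norm_sub' y x]
  gcongr

/-- With principal branches, `(s/ħ²)^(-ν/2)` cancels the prefactor of `I_ν (2 √s / ħ)`, so only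
the power series in `s/ħ²` remains. -/
theorem kernel_eq_kernelProfile (hp : -(n : ℝ) < p) (hħ : 0 < ħ) (z w : Cn n) :
    kernel n p ħ z w = kernelProfile (n + p) ħ (dot z w) := by
  have hΓ : 0 < Real.Gamma (n + p) := Real.Gamma_pos_of_pos (by linarith)
  unfold kernel
  split_ifs with h
  · rw [h, kernelProfile, tsum_eq_single 0]
    · simp [poch, hΓ.ne']
    · intro l hl; simp [hl]
  · set s := dot z w
    have hh : (ħ : ℂ) ≠ 0 := by exact_mod_cast hħ.ne'
    have hx : 2 * s ^ (1 / 2 : ℂ) / (ħ : ℂ) / 2 = s ^ (1 / 2 : ℂ) / ħ := by ring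
    have hlog1 : Complex.log (s / (ħ : ℂ) ^ 2) = Complex.log s - 2 * Real.log ħ := by
      have : s / (ħ : ℂ) ^ 2 = ((ħ ^ 2)⁻¹ : ℝ) * s := by push_cast; field_simp
      rw [this, Complex.log_ofReal_mul (by positivity) h, Real.log_inv, Real.log_pow]
      push_cast; ring
    have hsq : s ^ (1 / 2 : ℂ) ≠ 0 := by simp [Complex.cpow_eq_zero_iff, h]
    have hlog2 : Complex.log (s ^ (1 / 2 : ℂ) / ħ) = Complex.log s / 2 - Real.log ħ := by
      have h1 : s ^ (1 / 2 : ℂ) / ħ = ((ħ)⁻¹ : ℝ) * s ^ (1 / 2 : ℂ) := by push_cast; field_simp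
      have him : (Complex.log s * (1 / 2)).im = (Complex.log s).im / 2 := by
        rw [show Complex.log s * (1 / 2) = Complex.log s / (2 : ℝ) by push_cast; ring,
          Complex.div_ofReal_im]
      have h2 : Complex.log (s ^ (1 / 2 : ℂ)) = Complex.log s / 2 := by
        rw [Complex.cpow_def_of_ne_zero h, Complex.log_exp]
        · ring
        · rw [him]; linarith [Complex.neg_pi_lt_log_im s, Real.pi_pos]
        · rw [him]; linarith [Complex.log_im_le_pi s, Real.pi_pos]
      rw [h1, Complex.log_ofReal_mul (by positivity) hsq, h2, Real.log_inv]
      push_cast; ring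
    have hpow : (s / (ħ : ℂ) ^ 2) ^ (((1 - p - n) / 2 : ℝ) : ℂ) *
        (s ^ (1 / 2 : ℂ) / ħ) ^ ((n + p - 1 : ℝ) : ℂ) = 1 := by
      rw [Complex.cpow_def_of_ne_zero (div_ne_zero h (pow_ne_zero 2 hh)),
        Complex.cpow_def_of_ne_zero (div_ne_zero hsq hh), ← Complex.exp_add, hlog1, hlog2,
        ← Complex.exp_zero]
      congr 1
      push_cast; ring
    have hhalf : (s ^ (1 / 2 : ℂ)) ^ 2 = s := by
      rw [one_div]; exact Complex.cpow_nat_inv_pow s two_ne_zero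
    rw [besselI, hx, mul_assoc, ← mul_assoc _ (_ ^ _) (tsum _), hpow, one_mul, kernelProfile,
      ← tsum_mul_left]
    refine tsum_congr fun l => ?_
    have hl : Real.Gamma (n + p - 1 + l + 1) = poch (n + p) l * Real.Gamma (n + p) := by
      rw [poch, div_mul_cancel₀ _ hΓ.ne']; congr 1; ring
    have hq : (poch (n + p) l : ℂ) ≠ 0 := by
      exact_mod_cast (poch_pos (b := n + p) (by linarith) l).ne'
    have hg : (Real.Gamma (n + p) : ℂ) ≠ 0 := by exact_mod_cast hΓ.ne'
    have hf : (l.factorial : ℂ) ≠ 0 := by exact_mod_cast l.factorial_ne_zero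
    rw [hl, pow_mul, div_pow, hhalf]
    push_cast
    field_simp

theorem hasSum_kernelPart (hp : -(n : ℝ) < p) (hħ : 0 < ħ) (z w : Cn n) :
    HasSum (fun l : ℕ => kernelPart n p ħ l z w) (kernel n p ħ z w) := by
  rw [kernel_eq_kernelProfile hp hħ]
  exact hasSum_kernelProfile (by linarith) (dot z w)

theorem conj_kernel (hp : -(n : ℝ) < p) (hħ : 0 < ħ) (z w : Cn n) :
    conj (kernel n p ħ z w) = kernel n p ħ w z := by
  have h := Complex.hasSum_conj'.2 (hasSum_kernelPart hp hħ z w)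
  simp only [conj_kernelPart] at h
  exact h.unique (hasSum_kernelPart hp hħ w z)

theorem continuous_kernel (hp : -(n : ℝ) < p) (hħ : 0 < ħ) :
    Continuous fun q : Cn n × Cn n => kernel n p ħ q.1 q.2 := by
  simp only [kernel_eq_kernelProfile hp hħ]
  refine (differentiable_kernelProfile (by linarith) ħ).continuous.comp ?_
  unfold dot
  fun_prop

theorem differentiable_kernel (hp : -(n : ℝ) < p) (hħ : 0 < ħ) (z : Cn n) :
    Differentiable ℂ fun w : Cn n => kernel n p ħ w z := by
  simp only [kernel_eq_kernelProfile hp hħ]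
  refine (differentiable_kernelProfile (by linarith) ħ).comp ?_
  unfold dot
  fun_prop

end KernelSeries

open Filter Topology

/-! ### Pairings in `L²` -/

section L2Pairing
variable {α : Type*} [MeasurableSpace α] {μ : Measure α} {f g : α → ℂ}

theorem integrable_mul_conj (hf : MemLp f 2 μ) (hg : MemLp g 2 μ) :
    Integrable (fun w => f w * conj (g w)) μ :=
  hf.integrable_mul hg.star

theorem inner_toLp (hg : MemLp g 2 μ) (F : Lp ℂ 2 μ) (hF : F =ᵐ[μ] f) :
    inner ℂ (hg.toLp g) F = ∫ w, f w * conj (g w) ∂μ := by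
  rw [L2.inner_def]
  refine integral_congr_ae ?_
  filter_upwards [hg.coeFn_toLp, hF] with w h1 h2
  rw [h1, h2, RCLike.inner_apply]

end L2Pairing

variable {n : ℕ} {p ħ : ℝ}

/-! ### Pairing with homogeneous polynomials -/

section HomogeneousComponents

/-- Pairing an entire function with a homogeneous polynomial only sees the component of the same
degree: average the pairing over the circle action, which preserves the measure. -/
theorem integral_mul_conj_eq_integral_taylorTerm (hn : 1 ≤ n) (hp : -(n : ℝ) < p) (hħ : 0 < ħ)
    {f : Cn n → ℂ} (hf : f ∈ entireSpace n p ħ) {l : ℕ} {g : Cn n → ℂ} (hg : g ∈ homogSpace n l) :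
    ∫ z, f z * conj (g z) ∂fockMeasure n p ħ =
      ∫ z, taylorTerm f l z * conj (g z) ∂fockMeasure n p ħ := by
  have := isFiniteMeasure_fockMeasure hn hp hħ
  set μ := fockMeasure n p ħ
  have hgE := homogSpace_le_entireSpace hn hp hħ l hg
  have hfc := hf.1.continuous
  have hgc := hgE.1.continuous
  have hpair : Continuous fun z => f z * conj (g z) := hfc.mul (Complex.continuous_conj.comp hgc)
  set u : ℝ → ℂ := circleMap 0 1
  have hu : ∀ θ, ‖u θ‖ = 1 := fun θ => by simp [u, norm_circleMap_zero]
  have huc : Continuous u := continuous_circleMap 0 1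
  have hT : ∀ θ, MeasurePreserving (fun z : Cn n => u θ • z) μ μ := fun θ =>
    measurePreserving_torus hn hp hħ (fun _ => u θ) fun _ => hu θ
  set G : ℝ → Cn n → ℂ := fun θ z => (u θ)⁻¹ ^ l * f (u θ • z) * conj (g z)
  have hG : ∀ θ z, G θ z = f (u θ • z) * conj (g (u θ • z)) := by
    intro θ z
    have hconj : conj (u θ) = (u θ)⁻¹ := (Complex.inv_eq_conj (hu θ)).symm
    simp only [G, apply_smul_of_mem_homogSpace hg, map_mul, map_pow, hconj]
    ring
  have hGcont : Continuous fun q : ℝ × Cn n => G q.1 q.2 := by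
    simp only [hG]
    exact hpair.comp ((huc.comp continuous_fst).smul continuous_snd)
  have hint : Integrable (fun z => f z * conj (g z)) μ := integrable_mul_conj hf.2 hgE.2
  have hGint : ∀ θ, Integrable (G θ) μ := fun θ => by
    have : G θ = (fun z => f z * conj (g z)) ∘ fun z => u θ • z := funext fun z => hG θ z
    rw [this]
    exact (hT θ).integrable_comp_of_integrable hint
  have hGval : ∀ θ, ∫ z, G θ z ∂μ = ∫ z, f z * conj (g z) ∂μ := fun θ => by
    conv_rhs => rw [← (hT θ).map_eq]
    rw [integral_map (hT θ).aemeasurable hpair.aestronglyMeasurable]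
    simp only [hG]
  have hGnorm : ∀ θ, ∫ z, ‖G θ z‖ ∂μ = ∫ z, ‖f z * conj (g z)‖ ∂μ := fun θ => by
    conv_rhs => rw [← (hT θ).map_eq]
    rw [integral_map (hT θ).aemeasurable hpair.norm.aestronglyMeasurable]
    simp only [hG]
  have hprod : Integrable (Function.uncurry G)
      ((volume.restrict (Set.uIoc 0 (2 * Real.pi))).prod μ) := by
    rw [integrable_prod_iff (f := Function.uncurry G) hGcont.aestronglyMeasurable]
    refine ⟨Eventually.of_forall hGint, ?_⟩
    simp only [Function.uncurry_apply_pair, hGnorm]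
    exact intervalIntegrable_const.def'
  have hpi : (Real.pi : ℂ) ≠ 0 := by exact_mod_cast Real.pi_ne_zero
  calc ∫ z, f z * conj (g z) ∂μ
      = (2 * Real.pi : ℂ)⁻¹ * ∫ θ in (0 : ℝ)..2 * Real.pi, ∫ z, G θ z ∂μ := by
        simp only [hGval, intervalIntegral.integral_const, sub_zero, Complex.real_smul]
        push_cast
        field_simp
    _ = (2 * Real.pi : ℂ)⁻¹ * ∫ z, (∫ θ in (0 : ℝ)..2 * Real.pi, G θ z) ∂μ := by
        rw [intervalIntegral_integral_swap hprod]
    _ = ∫ z, taylorTerm f l z * conj (g z) ∂μ := by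
        rw [← integral_const_mul]
        refine integral_congr_ae (Eventually.of_forall fun z => ?_)
        simp only [taylorTerm_eq_circle_average hf.1 l z, G, intervalIntegral.integral_mul_const, u]
        ring

end HomogeneousComponents

/-! ### Reproducing kernels of the homogeneous polynomials -/

section KernelPart

theorem memLp_normMonomial (hn : 1 ≤ n) (hp : -(n : ℝ) < p) (hħ : 0 < ħ) (k : Fin n → ℕ) :
    MemLp (normMonomial p ħ k) 2 (fockMeasure n p ħ) :=
  (normMonomial_mem_entireSpace hn hp hħ k).2

theorem memLp_kernelPart (hn : 1 ≤ n) (hp : -(n : ℝ) < p) (hħ : 0 < ħ) (l : ℕ) (z : Cn n) :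
    MemLp (fun w => kernelPart n p ħ l w z) 2 (fockMeasure n p ħ) :=
  (homogSpace_le_entireSpace hn hp hħ l (kernelPart_mem_homogSpace hp hħ l z)).2

theorem integral_mul_conj_kernelPart (hn : 1 ≤ n) (hp : -(n : ℝ) < p) (hħ : 0 < ħ)
    {f : Cn n → ℂ} (hf : MemLp f 2 (fockMeasure n p ħ)) (l : ℕ)
    (z : Cn n) :
    ∫ w, f w * conj (kernelPart n p ħ l w z) ∂fockMeasure n p ħ =
      ∑ k ∈ Finset.piAntidiag (Finset.univ : Finset (Fin n)) l,
        (∫ w, f w * conj (normMonomial p ħ k w) ∂fockMeasure n p ħ) * normMonomial p ħ k z := by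
  simp only [conj_kernelPart]
  simp only [kernelPart_eq_sum hp hħ, Finset.mul_sum]
  rw [integral_finsetSum]
  · refine Finset.sum_congr rfl fun k _ => ?_
    rw [← integral_mul_const]
    exact integral_congr_ae (Eventually.of_forall fun w => by ring)
  · intro k _
    refine ((integrable_mul_conj hf (memLp_normMonomial hn hp hħ k)).mul_const
      (normMonomial p ħ k z)).congr (Eventually.of_forall fun w => by ring)

theorem isReproducingKernel_kernelPart (hn : 1 ≤ n) (hp : -(n : ℝ) < p) (hħ : 0 < ħ) (l : ℕ) :
    IsReproducingKernel (fockMeasure n p ħ) (homogSpace n l) (kernelPart n p ħ l) := by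
  refine ⟨kernelPart_mem_homogSpace hp hħ l, fun f hf z => ?_⟩
  have hmem : ∀ g ∈ homogSpace n l, MemLp g 2 (fockMeasure n p ħ) := fun g hg =>
    (homogSpace_le_entireSpace hn hp hħ l hg).2
  refine ⟨integrable_mul_conj (hmem f hf) (memLp_kernelPart hn hp hħ l z), ?_⟩
  have hT := memLp_kernelPart hn hp hħ l z
  have hspan := homogSpace_eq_span (n := n) hp hħ l
  rw [hspan] at hf hmem
  induction hf using Submodule.span_induction with
  | mem f hf =>
    obtain ⟨m, hm, rfl⟩ := hf
    rw [integral_mul_conj_kernelPart hn hp hħ (memLp_normMonomial hn hp hħ m)]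
    simp only [integral_normMonomial_mul_conj hn hp hħ]
    rw [Finset.sum_eq_single m]
    · simp
    · intro k _ hk; simp [hk.symm]
    · intro h0
      exact absurd (Finset.mem_piAntidiag.2 ⟨hm, fun _ _ => Finset.mem_univ _⟩) h0
  | zero => simp
  | add f g hf hg ihf ihg =>
    simp only [Pi.add_apply, add_mul]
    rw [integral_add (integrable_mul_conj (hmem f hf) hT) (integrable_mul_conj (hmem g hg) hT),
      ← ihf, ← ihg]
  | smul c f hf ih =>
    simp only [Pi.smul_apply, smul_eq_mul, mul_assoc]
    rw [integral_const_mul, ← ih]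

/-- The Taylor component of `f` at `z` is the pairing of `f` itself with `kernelPart l · z`. -/
theorem taylorTerm_eq_integral (hn : 1 ≤ n) (hp : -(n : ℝ) < p) (hħ : 0 < ħ)
    {f : Cn n → ℂ} (hf : f ∈ entireSpace n p ħ) (l : ℕ) (z : Cn n) :
    taylorTerm f l z = ∫ w, f w * conj (kernelPart n p ħ l w z) ∂fockMeasure n p ħ := by
  rw [integral_mul_conj_eq_integral_taylorTerm hn hp hħ hf (kernelPart_mem_homogSpace hp hħ l z)]
  exact ((isReproducingKernel_kernelPart hn hp hħ l).2 _ (taylorTerm_mem_homogSpace l hf.1) z).2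

end KernelPart

/-! ### The reproducing kernel of the Fock space -/

section Kernel

/-- The class in `L²` of the kernel of the homogeneous polynomials of degree `l`. -/
def kernelPartVec (hn : 1 ≤ n) (hp : -(n : ℝ) < p) (hħ : 0 < ħ) (l : ℕ) (z : Cn n) :
    Lp ℂ 2 (fockMeasure n p ħ) :=
  (memLp_kernelPart hn hp hħ l z).toLp _

/-- The sum in `L²` of the kernels of the homogeneous polynomials of all degrees. -/
def kernelVec (hn : 1 ≤ n) (hp : -(n : ℝ) < p) (hħ : 0 < ħ) (z : Cn n) :
    Lp ℂ 2 (fockMeasure n p ħ) :=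
  ∑' l, kernelPartVec hn hp hħ l z

theorem norm_kernelPartVec (hn : 1 ≤ n) (hp : -(n : ℝ) < p) (hħ : 0 < ħ) (l : ℕ) (z : Cn n) :
    ‖kernelPartVec hn hp hħ l z‖ = Real.sqrt (kernelBound (n + p) (len z ^ 2 / ħ ^ 2) l) := by
  have h1 : inner ℂ (kernelPartVec hn hp hħ l z) (kernelPartVec hn hp hħ l z) =
      kernelPart n p ħ l z z := by
    rw [((isReproducingKernel_kernelPart hn hp hħ l).2 _
      (kernelPart_mem_homogSpace hp hħ l z) z).2]
    exact inner_toLp _ _ (MemLp.coeFn_toLp _)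
  have h2 : kernelPart n p ħ l z z = (kernelBound (n + p) (len z ^ 2 / ħ ^ 2) l : ℝ) := by
    rw [kernelPart, dot_self, kernelBound]
    push_cast
    ring
  have h3 : ‖kernelPartVec hn hp hħ l z‖ ^ 2 = kernelBound (n + p) (len z ^ 2 / ħ ^ 2) l := by
    rw [← inner_self_eq_norm_sq (𝕜 := ℂ), h1, h2]
    exact Complex.ofReal_re _
  rw [← h3, Real.sqrt_sq (norm_nonneg _)]

theorem summable_norm_kernelPartVec (hn : 1 ≤ n) (hp : -(n : ℝ) < p) (hħ : 0 < ħ) (z : Cn n) :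
    Summable fun l => ‖kernelPartVec hn hp hħ l z‖ := by
  simp only [norm_kernelPartVec]
  exact summable_sqrt_kernelBound (by linarith) (by positivity)

theorem coeFn_kernelVec (hn : 1 ≤ n) (hp : -(n : ℝ) < p) (hħ : 0 < ħ) (z : Cn n) :
    kernelVec hn hp hħ z =ᵐ[fockMeasure n p ħ] fun w => kernel n p ħ w z := by
  have hfin : ∑' l, ‖kernelPartVec hn hp hħ l z‖ₑ ≠ ⊤ := by
    simp only [enorm_eq_nnnorm]
    exact ENNReal.tsum_coe_ne_top_iff_summable.2
      (NNReal.summable_coe.1 (by simpa using summable_norm_kernelPartVec hn hp hħ z))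
  have hae : ∀ᵐ w ∂fockMeasure n p ħ, ∀ l,
      kernelPartVec hn hp hħ l z w = kernelPart n p ħ l w z :=
    ae_all_iff.2 fun l => (memLp_kernelPart hn hp hħ l z).coeFn_toLp
  filter_upwards [Lp.hasSum_coeFn_tsum hfin, hae] with w h1 h2
  simp only [h2] at h1
  exact h1.unique (hasSum_kernelPart hp hħ w z)

theorem memLp_kernel (hn : 1 ≤ n) (hp : -(n : ℝ) < p) (hħ : 0 < ħ)
    (z : Cn n) : MemLp (fun w => kernel n p ħ w z) 2 (fockMeasure n p ħ) :=
  (memLp_congr_ae (coeFn_kernelVec hn hp hħ z)).1 (Lp.memLp _)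

theorem toLp_kernel (hn : 1 ≤ n) (hp : -(n : ℝ) < p) (hħ : 0 < ħ) (z : Cn n) :
    (memLp_kernel hn hp hħ z).toLp _ = kernelVec hn hp hħ z :=
  Lp.ext ((MemLp.coeFn_toLp _).trans (coeFn_kernelVec hn hp hħ z).symm)

theorem hasSum_inner_kernelPartVec (hn : 1 ≤ n) (hp : -(n : ℝ) < p) (hħ : 0 < ħ)
    (F : Lp ℂ 2 (fockMeasure n p ħ)) (z : Cn n) :
    HasSum (fun l => inner ℂ (kernelPartVec hn hp hħ l z) F) (inner ℂ (kernelVec hn hp hħ z) F) :=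
  ((summable_norm_kernelPartVec hn hp hħ z).of_norm.hasSum.mapL (innerSLFlip ℂ F))

/-- The reproducing property in terms of `L²` classes: the Taylor components of `f`
at `z` are the pairings of `f` with the homogeneous parts of the kernel. -/
theorem inner_kernelVec (hn : 1 ≤ n) (hp : -(n : ℝ) < p) (hħ : 0 < ħ)
    {f : Cn n → ℂ} (hf : f ∈ entireSpace n p ħ)
    {F : Lp ℂ 2 (fockMeasure n p ħ)} (hF : F =ᵐ[fockMeasure n p ħ] f) (z : Cn n) :
    inner ℂ (kernelVec hn hp hħ z) F = f z := by
  have h := hasSum_inner_kernelPartVec hn hp hħ F z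
  have h2 : ∀ l, inner ℂ (kernelPartVec hn hp hħ l z) F = taylorTerm f l z := fun l => by
    rw [taylorTerm_eq_integral hn hp hħ hf]
    exact inner_toLp _ _ hF
  simp only [h2] at h
  exact h.unique (hasSum_taylorTerm hf.1 z)

theorem isReproducingKernel_kernel (hn : 1 ≤ n) (hp : -(n : ℝ) < p) (hħ : 0 < ħ) :
    IsReproducingKernel (fockMeasure n p ħ) (entireSpace n p ħ) (kernel n p ħ) := by
  refine ⟨fun z => ⟨differentiable_kernel hp hħ z, memLp_kernel hn hp hħ z⟩, fun f hf z =>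
    ⟨integrable_mul_conj hf.2 (memLp_kernel hn hp hħ z), ?_⟩⟩
  rw [← inner_kernelVec hn hp hħ hf hf.2.coeFn_toLp z, ← toLp_kernel hn hp hħ z]
  exact inner_toLp _ _ hf.2.coeFn_toLp

/-- Every element of `L²`, paired with the kernel, gives an entire function. -/
theorem differentiable_inner_kernelVec (hn : 1 ≤ n) (hp : -(n : ℝ) < p) (hħ : 0 < ħ)
    (F : Lp ℂ 2 (fockMeasure n p ħ)) :
    Differentiable ℂ fun z => inner ℂ (kernelVec hn hp hħ z) F := by
  have hb : 0 < n + p := by linarith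
  have hsum : (fun z => inner ℂ (kernelVec hn hp hħ z) F) =
      fun z => ∑' l, inner ℂ (kernelPartVec hn hp hħ l z) F :=
    funext fun z => (hasSum_inner_kernelPartVec hn hp hħ F z).tsum_eq.symm
  rw [hsum]
  refine differentiable_tsum_of_norm_le_on_ball (fun l => ?_) fun x =>
    ⟨fun l => Real.sqrt (kernelBound (n + p) (n * (‖x‖ + 2) ^ 2 / ħ ^ 2) l) * ‖F‖,
      (summable_sqrt_kernelBound hb (by positivity)).mul_right _, fun l y hy => ?_⟩
  · have h : ∀ z, inner ℂ (kernelPartVec hn hp hħ l z) F =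
        ∑ k ∈ Finset.piAntidiag (Finset.univ : Finset (Fin n)) l,
          (∫ w, F w * conj (normMonomial p ħ k w) ∂fockMeasure n p ħ) * normMonomial p ħ k z :=
      fun z => (inner_toLp _ _ (ae_eq_refl _)).trans
        (integral_mul_conj_kernelPart hn hp hħ (Lp.memLp F) l z)
    simp only [h]
    exact Differentiable.fun_sum fun k _ => (differentiable_normMonomial k).const_mul _
  · refine (norm_inner_le_norm _ _).trans ?_
    rw [norm_kernelPartVec]
    refine mul_le_mul_of_nonneg_right (Real.sqrt_le_sqrt
      (kernelBound_mono hb (by positivity) ?_ l)) (norm_nonneg _)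
    have hy' : ‖y‖ ≤ ‖x‖ + 2 := by
      rw [mem_ball_iff_norm] at hy
      linarith [norm_le_norm_add_norm_sub' y x]
    have : len y ^ 2 ≤ n * (‖x‖ + 2) ^ 2 := by
      rw [len_sq]
      calc ∑ i, ‖y i‖ ^ 2 ≤ ∑ _i : Fin n, (‖x‖ + 2) ^ 2 :=
            Finset.sum_le_sum fun i _ => by gcongr; exact (norm_le_pi_norm y i).trans hy'
        _ = n * (‖x‖ + 2) ^ 2 := by simp
    gcongr

end Kernel

/-! ### Hilbert space structure -/

section HilbertSpace

theorem eq_of_ae_eq_fockMeasure (hn : 1 ≤ n) (hp : -(n : ℝ) < p) (hħ : 0 < ħ)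
    {f g : Cn n → ℂ} (hf : Continuous f) (hg : Continuous g)
    (h : f =ᵐ[fockMeasure n p ħ] g) : f = g :=
  (Continuous.ae_eq_iff_eq volume hf hg).1
    ((volume_absolutelyContinuous_fockMeasure hn hp hħ).ae_eq h)

/-- An `L²` limit `F` of entire functions is represented by the entire function
`z ↦ ⟨T(·, z), F⟩`, which is the pointwise limit of the approximating functions. -/
theorem isClosed_fockSpace (hn : 1 ≤ n) (hp : -(n : ℝ) < p) (hħ : 0 < ħ) :
    IsClosed (fockSpace n p ħ : Set (Lp ℂ 2 (fockMeasure n p ħ))) := by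
  refine isClosed_of_closure_subset fun F hF => ?_
  obtain ⟨Fs, hFs, hlim⟩ := mem_closure_iff_seq_limit.1 hF
  choose fs hfs hfs_ae using hFs
  obtain ⟨ns, hns, hae⟩ := (tendstoInMeasure_of_tendsto_Lp hlim).exists_seq_tendsto_ae
  have hFf : F =ᵐ[fockMeasure n p ħ] fun z => inner ℂ (kernelVec hn hp hħ z) F := by
    filter_upwards [hae, ae_all_iff.2 hfs_ae] with z h1 h2
    refine tendsto_nhds_unique h1 ?_
    have h3 : ∀ i, Fs (ns i) z = inner ℂ (kernelVec hn hp hħ z) (Fs (ns i)) := fun i => by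
      rw [h2, inner_kernelVec hn hp hħ (hfs _) (hfs_ae _)]
    simp only [h3]
    exact tendsto_const_nhds.inner (hlim.comp hns.tendsto_atTop)
  exact ⟨_, ⟨differentiable_inner_kernelVec hn hp hħ F,
    (memLp_congr_ae hFf).1 (Lp.memLp F)⟩, hFf⟩

theorem completeSpace_fockSpace (hn : 1 ≤ n) (hp : -(n : ℝ) < p) (hħ : 0 < ħ)
    : CompleteSpace (fockSpace n p ħ) :=
  (isClosed_fockSpace hn hp hħ).completeSpace_coe

/-- The class of a normalized monomial, as an element of the Fock space. -/
def monomialVec (hn : 1 ≤ n) (hp : -(n : ℝ) < p) (hħ : 0 < ħ) (k : Fin n → ℕ) :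
    fockSpace n p ħ :=
  ⟨(memLp_normMonomial hn hp hħ k).toLp _, normMonomial p ħ k,
    normMonomial_mem_entireSpace hn hp hħ k, (memLp_normMonomial hn hp hħ k).coeFn_toLp⟩

theorem coeFn_monomialVec (hn : 1 ≤ n) (hp : -(n : ℝ) < p) (hħ : 0 < ħ) (k : Fin n → ℕ) :
    ((monomialVec hn hp hħ k : Lp ℂ 2 (fockMeasure n p ħ)) : Cn n → ℂ)
      =ᵐ[fockMeasure n p ħ] normMonomial p ħ k :=
  (memLp_normMonomial hn hp hħ k).coeFn_toLp

theorem orthonormal_monomialVec (hn : 1 ≤ n) (hp : -(n : ℝ) < p) (hħ : 0 < ħ)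
    : Orthonormal ℂ (monomialVec hn hp hħ) := by
  rw [orthonormal_iff_ite]
  intro k m
  have h : inner ℂ (monomialVec hn hp hħ k) (monomialVec hn hp hħ m) =
      ∫ w, normMonomial p ħ m w * conj (normMonomial p ħ k w) ∂fockMeasure n p ħ :=
    inner_toLp (memLp_normMonomial hn hp hħ k) _ (memLp_normMonomial hn hp hħ m).coeFn_toLp
  rw [h, integral_normMonomial_mul_conj hn hp hħ]
  simp only [eq_comm]

theorem inFock_span_normMonomial (hn : 1 ≤ n) (hp : -(n : ℝ) < p) (hħ : 0 < ħ)
    (s : Set (Fin n → ℕ)) :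
    inFock p ħ (Submodule.span ℂ (normMonomial p ħ '' s)) =
      Submodule.span ℂ (monomialVec hn hp hħ '' s) := by
  apply le_antisymm
  · rintro F ⟨g, hg, hFg⟩
    have key : ∃ G ∈ Submodule.span ℂ (monomialVec hn hp hħ '' s),
        ((G : Lp ℂ 2 (fockMeasure n p ħ)) : Cn n → ℂ) =ᵐ[fockMeasure n p ħ] g := by
      clear hFg
      induction hg using Submodule.span_induction with
      | mem g hg =>
        obtain ⟨k, hk, rfl⟩ := hg
        exact ⟨_, Submodule.subset_span ⟨k, hk, rfl⟩, coeFn_monomialVec hn hp hħ k⟩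
      | zero => exact ⟨0, Submodule.zero_mem _, Lp.coeFn_zero _ _ _⟩
      | add g₁ g₂ _ _ ih₁ ih₂ =>
        obtain ⟨G₁, hG₁, h₁⟩ := ih₁
        obtain ⟨G₂, hG₂, h₂⟩ := ih₂
        exact ⟨G₁ + G₂, Submodule.add_mem _ hG₁ hG₂, (Lp.coeFn_add _ _).trans (h₁.add h₂)⟩
      | smul c g _ ih =>
        obtain ⟨G, hG, h⟩ := ih
        exact ⟨c • G, Submodule.smul_mem _ c hG, (Lp.coeFn_smul _ _).trans (h.const_smul c)⟩
    obtain ⟨G, hG, hGg⟩ := key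
    have : F = G := Subtype.ext (Lp.ext (hFg.trans hGg.symm))
    exact this ▸ hG
  · rw [Submodule.span_le]
    rintro _ ⟨k, hk, rfl⟩
    exact ⟨normMonomial p ħ k, Submodule.subset_span ⟨k, hk, rfl⟩, coeFn_monomialVec hn hp hħ k⟩

/-- The monomials are complete: the Taylor components of `f` are combinations of the pairings of
`f` with monomials. -/
theorem orthogonal_span_monomialVec (hn : 1 ≤ n) (hp : -(n : ℝ) < p) (hħ : 0 < ħ) :
    (Submodule.span ℂ (Set.range (monomialVec hn hp hħ)))ᗮ = ⊥ := by
  rw [Submodule.eq_bot_iff]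
  rintro ⟨F, f, hf, hFf⟩ hF
  have h0 : ∀ k, ∫ w, f w * conj (normMonomial p ħ k w) ∂fockMeasure n p ħ = 0 := fun k => by
    rw [← inner_toLp (memLp_normMonomial hn hp hħ k) F hFf]
    exact (Submodule.mem_orthogonal _ _).1 hF _ (Submodule.subset_span ⟨k, rfl⟩)
  have hT : ∀ l z, taylorTerm f l z = 0 := fun l z => by
    rw [taylorTerm_eq_integral hn hp hħ hf, integral_mul_conj_kernelPart hn hp hħ hf.2]
    simp [h0]
  have hf0 : f = 0 := by
    ext z
    have := hasSum_taylorTerm hf.1 z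
    simp only [hT] at this
    exact this.unique hasSum_zero
  refine Subtype.ext (Lp.ext (hFf.trans ?_))
  rw [hf0]
  exact (Lp.coeFn_zero _ _ _).symm

theorem topologicalClosure_span_monomialVec (hn : 1 ≤ n) (hp : -(n : ℝ) < p) (hħ : 0 < ħ) :
    (Submodule.span ℂ (Set.range (monomialVec hn hp hħ))).topologicalClosure = ⊤ := by
  have := completeSpace_fockSpace hn hp hħ
  rw [Submodule.topologicalClosure_eq_top_iff]
  exact orthogonal_span_monomialVec hn hp hħ

theorem dense_inFock_polySpace (hn : 1 ≤ n) (hp : -(n : ℝ) < p) (hħ : 0 < ħ) :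
    Dense (inFock p ħ (polySpace n) : Set (fockSpace n p ħ)) := by
  rw [polySpace_eq_span hp hħ, ← Set.image_univ, inFock_span_normMonomial hn hp hħ, Set.image_univ,
    Submodule.dense_iff_topologicalClosure_eq_top]
  exact topologicalClosure_span_monomialVec hn hp hħ

theorem inFock_homogSpace (hn : 1 ≤ n) (hp : -(n : ℝ) < p) (hħ : 0 < ħ) (l : ℕ) :
    inFock p ħ (homogSpace n l) =
      Submodule.span ℂ (monomialVec hn hp hħ '' {k | ∑ i, k i = l}) := by
  rw [homogSpace_eq_span hp hħ, inFock_span_normMonomial hn hp hħ]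

theorem isHilbertSum_inFock_homogSpace (hn : 1 ≤ n) (hp : -(n : ℝ) < p) (hħ : 0 < ħ)
    : ∃ _ : CompleteSpace (fockSpace n p ħ),
    IsHilbertSum ℂ (fun l : ℕ => inFock p ħ (homogSpace n l))
      (fun l : ℕ => (inFock p ħ (homogSpace n l)).subtypeₗᵢ) := by
  have := completeSpace_fockSpace hn hp hħ
  refine ⟨this, ?_⟩
  have hfin : ∀ l, {k : Fin n → ℕ | ∑ i, k i = l}.Finite := fun l =>
    (Finset.piAntidiag Finset.univ l).finite_toSet.subset fun k hk => by
      simpa using hk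
  have hcomplete : ∀ l, CompleteSpace (inFock p ħ (homogSpace n l)) := fun l => by
    rw [inFock_homogSpace hn hp hħ]
    have := FiniteDimensional.span_of_finite ℂ ((hfin l).image (monomialVec hn hp hħ))
    exact FiniteDimensional.complete ℂ _
  refine IsHilbertSum.mkInternal _ (OrthogonalFamily.of_pairwise fun l m hlm => ?_) ?_
  · simp only [Function.onFun, inFock_homogSpace hn hp hħ]
    refine Submodule.isOrtho_span.2 ?_
    rintro _ ⟨k, rfl, rfl⟩ _ ⟨k', rfl, rfl⟩
    exact (orthonormal_monomialVec hn hp hħ).2 fun h => hlm (by rw [h])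
  · simp only [inFock_homogSpace hn hp hħ]
    rw [← Submodule.span_iUnion, ← Set.image_iUnion]
    have : (⋃ l, {k : Fin n → ℕ | ∑ i, k i = l}) = Set.univ :=
      Set.eq_univ_of_forall fun k => Set.mem_iUnion.2 ⟨_, rfl⟩
    rw [this, Set.image_univ, topologicalClosure_span_monomialVec]

theorem exists_hilbertBasis_normMonomial (hn : 1 ≤ n) (hp : -(n : ℝ) < p) (hħ : 0 < ħ) :
    ∃ b : HilbertBasis (Fin n → ℕ) ℂ (fockSpace n p ħ),
      ∀ k, ((b k : Lp ℂ 2 (fockMeasure n p ħ)) : Cn n → ℂ)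
        =ᵐ[fockMeasure n p ħ] normMonomial p ħ k := by
  have := completeSpace_fockSpace hn hp hħ
  refine ⟨HilbertBasis.mk (orthonormal_monomialVec hn hp hħ)
    (topologicalClosure_span_monomialVec hn hp hħ).ge, fun k => ?_⟩
  rw [HilbertBasis.coe_mk]
  exact coeFn_monomialVec hn hp hħ k

end HilbertSpace

end BesselFock

end

theorem mainTheorem2 (n : ℕ) (hn : 1 ≤ n) (p : ℝ) (hp : -(n : ℝ) < p) (ħ : ℝ) (hħ : 0 < ħ) :
    -- two elements of the space that agree almost everywhere are equal
    (∀ f ∈ BesselFock.entireSpace n p ħ, ∀ g ∈ BesselFock.entireSpace n p ħ,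
      f =ᵐ[BesselFock.fockMeasure n p ħ] g → f = g) ∧
    -- a) the analytic polynomials belong to the space and are dense
    BesselFock.polySpace n ≤ BesselFock.entireSpace n p ħ ∧
    Dense (BesselFock.inFock p ħ (BesselFock.polySpace n) : Set (BesselFock.fockSpace n p ħ)) ∧
    -- b) complete, and the Hilbert sum of the spaces of homogeneous polynomials; orthonormal basis
    (∃ _ : CompleteSpace (BesselFock.fockSpace n p ħ), IsHilbertSum ℂ
      (fun l : ℕ => BesselFock.inFock p ħ (BesselFock.homogSpace n l))
      (fun l : ℕ => (BesselFock.inFock p ħ (BesselFock.homogSpace n l)).subtypeₗᵢ)) ∧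
    (∃ b : HilbertBasis (Fin n → ℕ) ℂ (BesselFock.fockSpace n p ħ),
      ∀ k, ((b k : Lp ℂ 2 (BesselFock.fockMeasure n p ħ)) : BesselFock.Cn n → ℂ)
        =ᵐ[BesselFock.fockMeasure n p ħ] BesselFock.normMonomial p ħ k) ∧
    -- c) reproducing kernel
    BesselFock.IsReproducingKernel (BesselFock.fockMeasure n p ħ)
      (BesselFock.entireSpace n p ħ) (BesselFock.kernel n p ħ) ∧
    (∀ f ∈ BesselFock.entireSpace n p ħ, ∀ z,
      Integrable (fun w => f w * BesselFock.kernel n p ħ z w) (BesselFock.fockMeasure n p ħ) ∧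
      f z = ∫ w, f w * BesselFock.kernel n p ħ z w ∂(BesselFock.fockMeasure n p ħ)) ∧
    Continuous (fun q : BesselFock.Cn n × BesselFock.Cn n =>
      BesselFock.kernel n p ħ q.1 q.2) ∧
    (∀ z w, HasSum (fun l : ℕ => BesselFock.kernelPart n p ħ l z w)
      (BesselFock.kernel n p ħ z w)) ∧
    (∀ l : ℕ, BesselFock.IsReproducingKernel (BesselFock.fockMeasure n p ħ)
      (BesselFock.homogSpace n l) (BesselFock.kernelPart n p ħ l)) := by
  have hrep := BesselFock.isReproducingKernel_kernel hn hp hħ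
  refine ⟨fun f hf g hg h =>
      BesselFock.eq_of_ae_eq_fockMeasure hn hp hħ hf.1.continuous hg.1.continuous h,
    BesselFock.polySpace_le_entireSpace hn hp hħ, BesselFock.dense_inFock_polySpace hn hp hħ,
    BesselFock.isHilbertSum_inFock_homogSpace hn hp hħ,
    BesselFock.exists_hilbertBasis_normMonomial hn hp hħ, hrep, fun f hf z => ?_,
    BesselFock.continuous_kernel hp hħ, BesselFock.hasSum_kernelPart hp hħ,
    BesselFock.isReproducingKernel_kernelPart hn hp hħ⟩
  have h := hrep.2 f hf z
  simpa only [BesselFock.conj_kernel hp hħ] using h
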